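/- **Conventions.** Manifolds are smooth, finite-dimensional and without boundary. $G$ is a Lie group with Lie algebra $\mathfrak g=T_1G$. A symplectic form is a smooth closed nondegenerate two-form. For a smooth left action $\phi\colon G\times N\to N$ and $\xi\in\mathfrak g$, let $\xi_N(x)=T_1(g\mapsto\phi_g(x))\,\xi$ be the infinitesimal generator. The action is *Hamiltonian* on a symplectic manifold $(N,\omega)$ with ($Ad^*$-)equivariant momentum map $J\colon N\to\mathfrak g^*$ if $\phi_g^*\omega=\omega$ for all $g\in G$, $J$ is smooth, $i_{\xi_N}\omega=dJ_\xi$ for all $\xi\in\mathfrak g$, where $J_\xi(x)=\langle J(x),\xi\rangle$, and $\langle J(\phi_g(x)),\xi\rangle=\langle J(x),Ad_{g^{-1}}\xi\rangle$ for all $g\in G$, $x\in N$, $\xi\in\mathfrak g$. Let $(M,\omega)$ be a symplectic manifold with a Hamiltonian action $\phi\colon G\times M\to M$ and equivariant momentum map $J\colon M\to\mathfrak g^*$. Let - $b_\omega\colon TM\to T^*M$, $\langle b_\omega(v_x),w_x\rangle=\omega(v_x,w_x)$; - $\phi^{TM}_g=T\phi_g$ and $\phi^{T^*M}_g(\alpha_x)=\alpha_x\circ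 T_{\phi_g(x)}\phi_{g^{-1}}$ be the tangent and cotangent lifts of $\phi$; - $J_{T^*M}\colon T^*M\to\mathfrak g^*$, $\langle J_{T^*M}(\alpha_x),\xi\rangle=\langle\alpha_x,\xi_M(x)\rangle$; - $\omega^c$ be the complete lift of $\omega$ to $TM$: if $\omega=\frac12\omega_{ij}\,dx^i\wedge dx^j$ then $\omega^c=\frac12 v^k\frac{\partial\omega_{ij}}{\partial x^k}\,dx^i\wedge dx^j+\omega_{ij}\,dv^i\wedge dx^j$ in the induced coordinates $(x^i,v^i)$ of $TM$. **Theorem.** 1. $b_\omega\colon TM\to T^*M$ is an isomorphism of smooth vector bundles (linear and bijective on fibres over the identity of $M$, and a diffeomorphism), $\phi^{T^*M}$ is a smooth action, and $b_\omega$ is $G$-equivariant: $b_\omega\circ\phi^{TM}_g=\phi^{T^*M}_g\circ b_\omega$ for all $g\in G$. 2. $\omega^c$ is a symplectic form on $TM$, and $\phi^{TM}$ is a Hamiltonian action on $(TM,\omega^c)$ with equivariant momentum map $J_{TM}\colon TM\to\mathfrak g^*$ given by $$\langle J_{TM}(v_x),\xi\rangle=v_x(J_\xi)=dJ_\xi(x)(v_x),\qquad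 v_x\in TM,\ \xi\in\mathfrak g .$$ Equivalently, $J_{TM}=-J_{T^*M}\circ b_\omega$. -/

import Mathlib

open scoped Manifold ContDiff

noncomputable section

namespace TangentReduction

section Forms

variable {E : Type*} [NormedAddCommGroup E] [NormedSpace ℝ E]
  {H : Type*} [TopologicalSpace H] (I : ModelWithCorners ℝ E H)
  (N : Type*) [TopologicalSpace N] [ChartedSpace H N]

/-- A (not necessarily smooth) differential two-form on `N`: an alternating bilinear form on each
tangent space. -/
abbrev TwoForm : Type _ := (x : N) → TangentSpace I x [⋀^Fin 2]→L[ℝ] ℝ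

variable {I N}

/-- The coordinate expression of a two-form in the chart around `x₀`: its pullback by the inverse
of the chart, a map from the model space `E` to the alternating forms on `E`. -/
def chartForm (Ω : TwoForm I N) (x₀ : N) (y : E) : E [⋀^Fin 2]→L[ℝ] ℝ :=
  (Ω ((extChartAt I x₀).symm y)).compContinuousLinearMap
    (mfderivWithin 𝓘(ℝ, E) I (extChartAt I x₀).symm (Set.range I) y)

/-- A symplectic form: a smooth, closed, nondegenerate two-form. -/
structure IsSymplecticForm (Ω : TwoForm I N) : Prop where
  smooth : ∀ x₀ : N, ContDiffOn ℝ ∞ (chartForm Ω x₀) (extChartAt I x₀).target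
  closed : ∀ x₀ : N, ∀ y ∈ (extChartAt I x₀).target,
    extDerivWithin (chartForm Ω x₀) (Set.range I) y = 0
  nondegenerate : ∀ (x : N) (v : TangentSpace I x),
    (∀ w : TangentSpace I x, Ω x ![v, w] = 0) → v = 0

/-- The complete lift `Ω^c` of a two-form `Ω` on `N` to the tangent bundle. In the coordinates
`(xⁱ, vⁱ)` on the tangent bundle induced by coordinates `xⁱ` on `N`, for tangent vectors
`a = (a₁, a₂)` and `b = (b₁, b₂)` at `(x, v)`,
`Ω^c (a, b) = (∂_v Ω)_x (a₁, b₁) + Ω_x (a₁, b₂) + Ω_x (a₂, b₁)`.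
Equivalently, `(½ Ω_ij dxⁱ ∧ dxʲ)^c = ½ v^k ∂_k Ω_ij dxⁱ ∧ dxʲ + Ω_ij dvⁱ ∧ dxʲ`. The formula is
used in the chart around the base point of `p`, whose induced chart is the one that identifies the
tangent space of the tangent bundle at `p` with `E × E`.
See `completeLift_apply` for the formula. -/
def completeLift [IsManifold I 1 N] (Ω : TwoForm I N) : TwoForm I.tangent (TangentBundle I N) := fun p ↦
  let y : E := extChartAt I p.proj p.proj
  let v : E := p.snd
  let η : E [⋀^Fin 2]→L[ℝ] ℝ := fderivWithin ℝ (chartForm Ω p.proj) (Set.range I) y v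
  let σ : E [⋀^Fin 2]→L[ℝ] ℝ := chartForm Ω p.proj y
  let pr₁ : E × E →L[ℝ] E := ContinuousLinearMap.fst ℝ E E
  let pr₂ : E × E →L[ℝ] E := ContinuousLinearMap.snd ℝ E E
  (η.compContinuousLinearMap pr₁ +
    (σ.compContinuousLinearMap (pr₁ + pr₂) - σ.compContinuousLinearMap pr₁
      - σ.compContinuousLinearMap pr₂) : (E × E) [⋀^Fin 2]→L[ℝ] ℝ)

theorem completeLift_apply [IsManifold I 1 N] (Ω : TwoForm I N) (p : TangentBundle I N) (a b : E × E) :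
    (show (E × E) [⋀^Fin 2]→L[ℝ] ℝ from completeLift Ω p) ![a, b] =
      (show E [⋀^Fin 2]→L[ℝ] ℝ from fderivWithin ℝ (chartForm Ω p.proj) (Set.range I)
        (extChartAt I p.proj p.proj) p.snd) ![a.1, b.1] +
      (chartForm Ω p.proj (extChartAt I p.proj p.proj) ![a.1, b.2] +
        chartForm Ω p.proj (extChartAt I p.proj p.proj) ![a.2, b.1]) := by
  have key : ∀ (τ : E [⋀^Fin 2]→L[ℝ] ℝ) (a₁ a₂ b₁ b₂ : E),
      τ ![a₁ + a₂, b₁ + b₂] - τ ![a₁, b₁] - τ ![a₂, b₂] = τ ![a₁, b₂] + τ ![a₂, b₁] := by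
    intro τ a₁ a₂ b₁ b₂
    have h1 : ∀ u v w : E, τ ![u + v, w] = τ ![u, w] + τ ![v, w] := fun u v w ↦ by
      have h := τ.map_update_add ![0, w] 0 u v
      have hu : ∀ z : E, Function.update (![0, w] : Fin 2 → E) 0 z = ![z, w] := fun z ↦ by
        ext i
        fin_cases i <;> rfl
      simp only [hu] at h
      exact h
    have h2 : ∀ u v w : E, τ ![w, u + v] = τ ![w, u] + τ ![w, v] := fun u v w ↦ by
      have h := τ.map_update_add ![w, 0] 1 u v
      have hu : ∀ z : E, Function.update (![w, 0] : Fin 2 → E) 1 z = ![w, z] := fun z ↦ by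
        ext i
        fin_cases i <;> rfl
      simp only [hu] at h
      exact h
    rw [h1, h2, h2]
    ring
  have hv : ∀ L : E × E →L[ℝ] E, (L ∘ ![a, b] : Fin 2 → E) = ![L a, L b] := fun L ↦ by
    ext i
    fin_cases i <;> rfl
  rw [← key]
  simp only [completeLift, ContinuousAlternatingMap.add_apply, ContinuousAlternatingMap.sub_apply,
    ContinuousAlternatingMap.compContinuousLinearMap_apply, hv]
  rfl

end Forms

section Cotangent

variable {E : Type*} [NormedAddCommGroup E] [NormedSpace ℝ E]
  {H : Type*} [TopologicalSpace H] (I : ModelWithCorners ℝ E H)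
  (N : Type*) [TopologicalSpace N] [ChartedSpace H N]

/-- The cotangent bundle. -/
abbrev CotangentBundle : Type _ :=
  Bundle.TotalSpace (E →L[ℝ] ℝ) (fun x : N ↦ TangentSpace I x →L[ℝ] ℝ)

variable {I N}

/-- The vector bundle morphism `b_Ω` from the tangent to the cotangent bundle,
`⟨b_Ω(v), w⟩ = Ω(v, w)`. -/
def flat (Ω : TwoForm I N) (p : TangentBundle I N) : CotangentBundle I N :=
  ⟨p.proj, (Ω p.proj).toContinuousLinearMap ![p.snd, 0] 1⟩

theorem flat_apply (Ω : TwoForm I N) (x : N) (v w : TangentSpace I x) :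
    (flat Ω ⟨x, v⟩).snd w = Ω x ![v, w] := by
  change Ω x (Function.update ![v, 0] 1 w) = Ω x ![v, w]
  congr 1
  ext i
  fin_cases i <;> rfl

end Cotangent

section Actions

variable {EG : Type*} [NormedAddCommGroup EG] [NormedSpace ℝ EG]
  {HG : Type*} [TopologicalSpace HG] (IG : ModelWithCorners ℝ EG HG)
  {G : Type*} [TopologicalSpace G] [ChartedSpace HG G] [Group G]
  {E : Type*} [NormedAddCommGroup E] [NormedSpace ℝ E]
  {H : Type*} [TopologicalSpace H] (I : ModelWithCorners ℝ E H)
  {N : Type*} [TopologicalSpace N] [ChartedSpace H N]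

/-- A smooth (left) action of the Lie group `G` on the manifold `N`. -/
structure IsSmoothAction (φ : G → N → N) : Prop where
  one_act : ∀ x, φ 1 x = x
  mul_act : ∀ g h x, φ (g * h) x = φ g (φ h x)
  smooth : ContMDiff (IG.prod I) I ∞ (fun p : G × N ↦ φ p.1 p.2)

/-- The adjoint action `Ad_g ξ`: the derivative at `1` of the conjugation `h ↦ g h g⁻¹`. (The
tangent space at `g 1 g⁻¹ = 1` is the Lie algebra.) -/
def Ad (g : G) : GroupLieAlgebra IG G →L[ℝ] GroupLieAlgebra IG G :=
  mfderiv IG IG (fun h : G ↦ g * h * g⁻¹) 1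

/-- The map `ξ ↦ ξ_N(x)` from the Lie algebra to the tangent space at `x`, where `ξ_N` is the
infinitesimal generator of the action: the derivative at `1` of the orbit map `g ↦ φ g x`. (For an
action, the tangent space at `φ 1 x = x` is the tangent space at `x`.) -/
def generator (φ : G → N → N) (x : N) : GroupLieAlgebra IG G →L[ℝ] TangentSpace I x :=
  mfderiv IG I (fun g : G ↦ φ g x) 1

/-- `φ` is a Hamiltonian action of `G` on `(N, Ω)` with `Ad^*`-equivariant momentum map `J`:
a smooth action by symplectomorphisms, with `i_{ξ_N} Ω = dJ_ξ` for all `ξ` in the Lie algebra,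
where `J_ξ(x) = ⟨J(x), ξ⟩`, and `J(φ_g(x)) = Ad^*_{g⁻¹} J(x)`. -/
structure IsHamiltonianAction (Ω : TwoForm I N) (φ : G → N → N)
    (J : N → GroupLieAlgebra IG G →L[ℝ] ℝ) : Prop where
  action : IsSmoothAction IG I φ
  symplectic : ∀ (g : G) (x : N) (v w : TangentSpace I x),
    Ω (φ g x) ![mfderiv I I (φ g) x v, mfderiv I I (φ g) x w] = Ω x ![v, w]
  smooth_momentum : ContMDiff (M' := EG →L[ℝ] ℝ) I 𝓘(ℝ, EG →L[ℝ] ℝ) ∞ J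
  momentum : ∀ (ξ : GroupLieAlgebra IG G) (x : N) (w : TangentSpace I x),
    Ω x ![generator IG I φ x ξ, w] = mfderiv I 𝓘(ℝ, ℝ) (fun z ↦ J z ξ) x w
  equivariant : ∀ (g : G) (x : N) (ξ : GroupLieAlgebra IG G),
    J (φ g x) ξ = J x (Ad IG g⁻¹ ξ)

/-- The tangent lift `φ^{TN}_g = T φ_g` of an action. -/
def tangentLift (φ : G → N → N) (g : G) (p : TangentBundle I N) : TangentBundle I N :=
  tangentMap I I (φ g) p

/-- The cotangent lift of an action, `g α_x = α_x ∘ T_{gx} φ_{g⁻¹}`. (For an action, the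
tangent space at `φ g⁻¹ (φ g x) = x` is the tangent space at `x`.) -/
def cotangentLift (φ : G → N → N) (g : G) (p : CotangentBundle I N) : CotangentBundle I N :=
  ⟨φ g p.proj,
    ContinuousLinearMap.comp (M₂ := TangentSpace I p.proj) p.snd
      (mfderiv I I (φ g⁻¹) (φ g p.proj))⟩

/-- The momentum map of the cotangent lifted action, `⟨J_{T^*N}(α_x), ξ⟩ = ⟨α_x, ξ_N(x)⟩`. -/
def cotangentMomentum (φ : G → N → N) (p : CotangentBundle I N) :
    GroupLieAlgebra IG G →L[ℝ] ℝ :=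
  p.snd.comp (generator IG I φ p.proj)

end Actions

end TangentReduction

end

/-!
# The tangent lift of a Hamiltonian action

Everything rests on one local fact. Let `s` be a closed two-form on a vector space `E` and let `θ`
be the one-form on `E × E` with `θ (x, v) (a₁, a₂) = s x (v, a₁)`, i.e. the pullback under `b_s` of
the tautological one-form of the cotangent bundle. Then the complete lift of `s` is `dθ`
(`extDeriv_tautForm`). Hence the complete lift of a closed form is closed, since `d ∘ d = 0`, and it
is natural: if `s = f^* t`, then `θ_s = (Tf)^* θ_t`, so the lifts are related by `(Tf)^*`
(`formLift_pullback`).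

`completeLift Ω` is defined at each point `p` of the tangent bundle by the chart centred at
`p.proj`. Naturality for changes of charts shows that the same coordinate formula holds throughout
every induced chart (`chartForm_completeLift`), so the complete lift is smooth and closed;
nondegeneracy is read off from the formula. Naturality for the symplectic maps `φ g` shows that the
tangent lift preserves the complete lift (`completeLift_tangentMap`).

In coordinates `b_Ω` is a smooth family of invertible linear maps, so it is a diffeomorphism
(`IsSymplecticForm.flatDiffeomorph`). Invariance of `Ω` says that `b_Ω` intertwines the tangent and
the cotangent lift (`IsHamiltonianAction.flat_tangentLift`), so that the cotangent lift inherits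
from the tangent lift that it is a smooth action.

The momentum map of the tangent lift is the fibre derivative `v ↦ dJ_ξ(v)`, and its equivariance is
the derivative of the equivariance of `J`. For the momentum equation, let `X` be the generator of
`ξ` in coordinates. The generator of the tangent lift is `(X, DX v)`
(`IsSmoothAction.generator_tangentLift`), and the equation for it follows by differentiating
`Ω (X, ·) = dJ_ξ` in the direction `v` and using the symmetry of the second derivative of `J_ξ`
(`formLift_generator`).
-/

noncomputable section

namespace TangentReduction

open scoped Topology

/-! ### Two-forms on a vector space and their complete lifts -/

theorem two_le_infty : (2 : WithTop ℕ∞) ≤ ∞ :=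
  WithTop.coe_le_coe.2 le_top

section VectorSpace

variable {E : Type*} [NormedAddCommGroup E] [NormedSpace ℝ E]
  {E' : Type*} [NormedAddCommGroup E'] [NormedSpace ℝ E']

variable (E) in
/-- The continuous linear map sending an alternating bilinear form to the corresponding curried
bilinear map. -/
def toBilin : (E [⋀^Fin 2]→L[ℝ] ℝ) →L[ℝ] E →L[ℝ] E →L[ℝ] ℝ :=
  (ContinuousLinearMap.compL ℝ E _ _
    (continuousMultilinearCurryFin1 ℝ E ℝ).toContinuousLinearEquiv.toContinuousLinearMap) ∘L
  ((continuousMultilinearCurryLeftEquiv ℝ (fun _ : Fin 2 ↦ E)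
      ℝ).toContinuousLinearEquiv.toContinuousLinearMap ∘L
    ContinuousAlternatingMap.toContinuousMultilinearMapCLM ℝ)

@[simp]
theorem toBilin_apply (τ : E [⋀^Fin 2]→L[ℝ] ℝ) (v w : E) : toBilin E τ v w = τ ![v, w] := by
  change τ _ = τ _
  congr 1
  ext i
  fin_cases i <;> rfl

variable (E) in
theorem contDiff_toBilin {n : WithTop ℕ∞} : ContDiff ℝ n (toBilin E) :=
  ContinuousLinearMap.contDiff (𝕜 := ℝ) (E := E [⋀^Fin 2]→L[ℝ] ℝ) (F := E →L[ℝ] E →L[ℝ] ℝ)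
    (toBilin E)

theorem apply_swap (τ : E [⋀^Fin 2]→L[ℝ] ℝ) (v w : E) : τ ![v, w] = -τ ![w, v] := by
  refine Eq.trans ?_ (τ.map_swap ![w, v] (zero_ne_one : (0 : Fin 2) ≠ 1))
  change τ _ = τ _
  congr 1
  ext i
  fin_cases i <;> rfl

omit [NormedAddCommGroup E] [NormedSpace ℝ E] [NormedAddCommGroup E'] [NormedSpace ℝ E'] in
theorem comp_vec (L : E → E') (a b : E) : (L ∘ ![a, b] : Fin 2 → E') = ![L a, L b] := by
  ext i
  fin_cases i <;> rfl

/-- The complete lift of a two-form `s` on a vector space `E`, as a two-form on `E × E`. The last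
three terms are the polarisation `(a, b) ↦ s (a₁, b₂) + s (a₂, b₁)`, written as a combination of
pullbacks so that it is visibly alternating; see `formLift_apply`. -/
def formLift (s : E → E [⋀^Fin 2]→L[ℝ] ℝ) (q : E × E) : (E × E) [⋀^Fin 2]→L[ℝ] ℝ :=
  (fderiv ℝ s q.1 q.2).compContinuousLinearMap (ContinuousLinearMap.fst ℝ E E) +
    ((s q.1).compContinuousLinearMap
        (ContinuousLinearMap.fst ℝ E E + ContinuousLinearMap.snd ℝ E E)
      - (s q.1).compContinuousLinearMap (ContinuousLinearMap.fst ℝ E E)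
      - (s q.1).compContinuousLinearMap (ContinuousLinearMap.snd ℝ E E))

theorem formLift_apply (s : E → E [⋀^Fin 2]→L[ℝ] ℝ) (q a b : E × E) :
    formLift s q ![a, b] = fderiv ℝ s q.1 q.2 ![a.1, b.1] +
      (s q.1 ![a.1, b.2] + s q.1 ![a.2, b.1]) := by
  have key : ∀ (τ : E [⋀^Fin 2]→L[ℝ] ℝ) (a₁ a₂ b₁ b₂ : E),
      τ ![a₁ + a₂, b₁ + b₂] - τ ![a₁, b₁] - τ ![a₂, b₂] = τ ![a₁, b₂] + τ ![a₂, b₁] := by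
    intro τ a₁ a₂ b₁ b₂
    simp only [← toBilin_apply, map_add, add_apply]
    ring
  rw [← key]
  simp only [formLift, ContinuousAlternatingMap.add_apply, ContinuousAlternatingMap.sub_apply,
    ContinuousAlternatingMap.compContinuousLinearMap_apply, comp_vec]
  rfl

/-- The one-form `θ` on `E × E` with `θ (x, v) (a₁, a₂) = s x (v, a₁)`: the contraction of the
two-form `s` with the position vector in the fibre. It is the pullback under `b_s` of the
tautological one-form of the cotangent bundle. -/
def tautForm (s : E → E [⋀^Fin 2]→L[ℝ] ℝ) (q : E × E) : (E × E) [⋀^Fin 1]→L[ℝ] ℝ :=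
  ContinuousAlternatingMap.ofSubsingleton ℝ (E × E) ℝ (0 : Fin 1)
    (toBilin E (s q.1) q.2 ∘L ContinuousLinearMap.fst ℝ E E)

theorem tautForm_apply (s : E → E [⋀^Fin 2]→L[ℝ] ℝ) (q : E × E) (a : Fin 1 → E × E) :
    tautForm s q a = s q.1 ![q.2, (a 0).1] := by
  simp [tautForm]

theorem contDiffAt_tautForm {n : WithTop ℕ∞} {s : E → E [⋀^Fin 2]→L[ℝ] ℝ} {q : E × E}
    (hs : ContDiffAt ℝ n s q.1) : ContDiffAt ℝ n (tautForm s) q := by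
  have h1 : ContDiffAt ℝ n
      (fun q : E × E ↦ toBilin E (s q.1) q.2 ∘L ContinuousLinearMap.fst ℝ E E) q := by
    refine ContDiffAt.clm_comp ?_ contDiffAt_const
    refine ContDiffAt.clm_apply ?_ contDiffAt_snd
    exact (contDiff_toBilin E).contDiffAt.comp q (hs.comp q contDiffAt_fst)
  exact (ContinuousAlternatingMap.ofSubsingletonLIE (𝕜 := ℝ) (E := E × E) (F := ℝ)
    (0 : Fin 1)).contDiff.contDiffAt.comp q h1

theorem fderiv_apply_vec {s : E → E [⋀^Fin 2]→L[ℝ] ℝ} {y : E}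
    (hs : DifferentiableAt ℝ s y) (v w z : E) :
    fderiv ℝ (fun y ↦ s y ![v, w]) y z = fderiv ℝ s y z ![v, w] := by
  have := fderiv_continuousAlternatingMap_apply_const_apply hs ![v, w] z
  exact this

theorem differentiableAt_toBilin {s : E → E [⋀^Fin 2]→L[ℝ] ℝ} {y : E}
    (hs : DifferentiableAt ℝ s y) : DifferentiableAt ℝ (fun z ↦ toBilin E (s z)) y :=
  ((contDiff_toBilin (n := 1) E).differentiable (by simp)).differentiableAt.comp y hs

theorem fderiv_toBilin_apply {s : E → E [⋀^Fin 2]→L[ℝ] ℝ} {y : E}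
    (hs : DifferentiableAt ℝ s y) (a v w : E) :
    fderiv ℝ (fun z ↦ toBilin E (s z)) y a v w = fderiv ℝ s y a ![v, w] := by
  have h := ((differentiableAt_toBilin hs).hasFDerivAt.clm_apply
    (hasFDerivAt_const v y)).clm_apply (hasFDerivAt_const w y)
  rw [← fderiv_apply_vec hs]
  simp only [toBilin_apply] at h
  rw [h.fderiv]
  simp

/-- The complete lift of a closed two-form is exact. For a general two-form the difference of the
two sides is the contraction of its exterior derivative with the position vector in the fibre. -/
theorem extDeriv_tautForm {s : E → E [⋀^Fin 2]→L[ℝ] ℝ} {q : E × E}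
    (hs : DifferentiableAt ℝ s q.1) (hc : extDeriv s q.1 = 0) :
    extDeriv (tautForm s) q = formLift s q := by
  have hb : HasFDerivAt (fun z : E × E ↦ toBilin E (s z.1))
      (fderiv ℝ (fun z ↦ toBilin E (s z)) q.1 ∘L ContinuousLinearMap.fst ℝ E E) q :=
    HasFDerivAt.comp (g := fun z ↦ toBilin E (s z)) q (differentiableAt_toBilin hs).hasFDerivAt
      (hasFDerivAt_fst (𝕜 := ℝ) (E := E) (F := E) (p := q))
  have hd (c : Fin 1 → E × E) (a : E × E) : fderiv ℝ (fun z ↦ tautForm s z c) q a =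
      fderiv ℝ s q.1 a.1 ![q.2, (c 0).1] + s q.1 ![a.2, (c 0).1] := by
    have h := (hb.clm_apply (hasFDerivAt_snd (𝕜 := ℝ) (p := q))).clm_apply
      (hasFDerivAt_const (c 0).1 q)
    have h' : HasFDerivAt (fun z ↦ tautForm s z c) _ q :=
      h.congr_of_eventuallyEq (.of_forall fun z ↦ by simp [tautForm_apply])
    rw [h'.fderiv]
    simp [add_comm, fderiv_toBilin_apply hs]
  ext c
  have h0 : DifferentiableAt ℝ (tautForm s) q := by
    have h1 : DifferentiableAt ℝ
        (fun q : E × E ↦ toBilin E (s q.1) q.2 ∘L ContinuousLinearMap.fst ℝ E E) q :=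
      (hb.differentiableAt.clm_apply differentiableAt_snd).clm_comp
        (differentiableAt_const _)
    exact (ContinuousAlternatingMap.ofSubsingletonLIE (𝕜 := ℝ) (E := E × E) (F := ℝ)
      (0 : Fin 1)).differentiableAt.comp q h1
  -- Closedness, evaluated on the fibre coordinate and the base components of the two vectors, turns
  -- the antisymmetrised derivatives of `s` into the derivative in the direction of the fibre.
  have hc' := DFunLike.congr_fun hc ![q.2, (c 0).1, (c 1).1]
  have e : c = ![c 0, c 1] := by
    ext i <;> fin_cases i <;> rfl
  rw [extDeriv_apply hs, Fin.sum_univ_three] at hc'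
  rw [extDeriv_apply h0, Fin.sum_univ_two, e, formLift_apply, hd, hd]
  have r0 : Fin.removeNth 0 ![q.2, (c 0).1, (c 1).1] = ![(c 0).1, (c 1).1] := by
    ext i; fin_cases i <;> rfl
  have r1 : Fin.removeNth 1 ![q.2, (c 0).1, (c 1).1] = ![q.2, (c 1).1] := by
    ext i; fin_cases i <;> rfl
  have r2 : Fin.removeNth 2 ![q.2, (c 0).1, (c 1).1] = ![q.2, (c 0).1] := by
    ext i; fin_cases i <;> rfl
  rw [r0, r1, r2, fderiv_apply_vec hs, fderiv_apply_vec hs, fderiv_apply_vec hs] at hc'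
  simp [Fin.removeNth] at hc' ⊢
  rw [apply_swap (s q.1) (c 1).2]
  linarith

/-- The tangent map of a map `f` between vector spaces, on the trivialised tangent bundles. -/
def tangentRep (f : E → E') (q : E × E) : E' × E' := (f q.1, fderiv ℝ f q.1 q.2)

theorem contDiffAt_tangentRep {m n : WithTop ℕ∞} {f : E → E'} {q : E × E}
    (hf : ContDiffAt ℝ n f q.1) (hmn : m + 1 ≤ n) : ContDiffAt ℝ m (tangentRep f) q := by
  refine ((hf.of_le (le_self_add.trans hmn)).comp q contDiffAt_fst).prodMk
    (ContDiffAt.clm_apply ?_ contDiffAt_snd)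
  exact (hf.fderiv_right hmn).comp q contDiffAt_fst

theorem fderiv_tangentRep_fst {f : E → E'} {q : E × E} (hf : ContDiffAt ℝ 2 f q.1) (a : E × E) :
    (fderiv ℝ (tangentRep f) q a).1 = fderiv ℝ f q.1 a.1 := by
  have h1 : DifferentiableAt ℝ f q.1 := hf.differentiableAt (by simp)
  have h2 := (contDiffAt_tangentRep (m := 1) hf (by norm_num)).differentiableAt (by simp)
  have h3 := h2.hasFDerivAt.fst.unique (h1.hasFDerivAt.comp q hasFDerivAt_fst)
  exact DFunLike.congr_fun h3 a

/-- If `s = f^* t`, then `θ_s = (Tf)^* θ_t`, so the exterior derivatives are related likewise. -/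
theorem extDeriv_tautForm_pullback {s : E → E [⋀^Fin 2]→L[ℝ] ℝ} {t : E' → E' [⋀^Fin 2]→L[ℝ] ℝ}
    {f : E → E'} {q : E × E} (hf : ContDiffAt ℝ ∞ f q.1) (ht : ContDiffAt ℝ ∞ t (f q.1))
    (h : ∀ᶠ z in 𝓝 q.1, s z = (t (f z)).compContinuousLinearMap (fderiv ℝ f z)) :
    extDeriv (tautForm s) q = (extDeriv (tautForm t) (tangentRep f q)).compContinuousLinearMap
      (fderiv ℝ (tangentRep f) q) := by
  rw [← extDeriv_pullback (r := ∞) ((contDiffAt_tautForm (q := tangentRep f q) ht).differentiableAt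
    (by simp)) (contDiffAt_tangentRep hf (m := ∞) (by simp)) (by simp; exact two_le_infty)]
  apply Filter.EventuallyEq.extDeriv_eq
  -- Being `C^∞` at a point does not spread to a neighbourhood, but being `C^2` does.
  have h' : ∀ᶠ z in 𝓝 q.1, ContDiffAt ℝ 2 f z :=
    (hf.of_le two_le_infty).eventually (by decide)
  filter_upwards [continuousAt_fst.eventually (h.and h')] with z hz
  ext a
  rw [ContinuousAlternatingMap.compContinuousLinearMap_apply, tautForm_apply, tautForm_apply, hz.1,
    ContinuousAlternatingMap.compContinuousLinearMap_apply, comp_vec, Function.comp_apply,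
    fderiv_tangentRep_fst hz.2]
  rfl

/-- The complete lift of closed forms is natural with respect to pullback. -/
theorem formLift_pullback {s : E → E [⋀^Fin 2]→L[ℝ] ℝ} {t : E' → E' [⋀^Fin 2]→L[ℝ] ℝ}
    {f : E → E'} {q : E × E} (hf : ContDiffAt ℝ ∞ f q.1) (ht : ContDiffAt ℝ ∞ t (f q.1))
    (hs : DifferentiableAt ℝ s q.1) (hsc : extDeriv s q.1 = 0) (htc : extDeriv t (f q.1) = 0)
    (h : ∀ᶠ z in 𝓝 q.1, s z = (t (f z)).compContinuousLinearMap (fderiv ℝ f z)) :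
    formLift s q = (formLift t (tangentRep f q)).compContinuousLinearMap
      (fderiv ℝ (tangentRep f) q) := by
  rw [← extDeriv_tautForm hs hsc, extDeriv_tautForm_pullback hf ht h,
    extDeriv_tautForm (q := tangentRep f q) (ht.differentiableAt (by simp)) htc]

theorem contDiffAt_formLift {s : E → E [⋀^Fin 2]→L[ℝ] ℝ} {q : E × E}
    (hs : ContDiffAt ℝ ∞ s q.1) :
    ContDiffAt ℝ ∞ (formLift s) q := by
  have h1 : ContDiffAt ℝ ∞ (fun q : E × E ↦ s q.1) q := hs.comp q contDiffAt_fst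
  have h2 : ContDiffAt ℝ ∞ (fun q : E × E ↦ fderiv ℝ s q.1 q.2) q :=
    ContDiffAt.clm_apply ((hs.fderiv_right (m := ∞) (by simp)).comp q contDiffAt_fst)
      contDiffAt_snd
  have h3 (L : E × E →L[ℝ] E) {g : E × E → E [⋀^Fin 2]→L[ℝ] ℝ} (hg : ContDiffAt ℝ ∞ g q) :
      ContDiffAt ℝ ∞ (fun q ↦ (g q).compContinuousLinearMap L) q :=
    (ContinuousLinearMap.contDiff (𝕜 := ℝ) (E := E [⋀^Fin 2]→L[ℝ] ℝ)
      (F := (E × E) [⋀^Fin 2]→L[ℝ] ℝ)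
      (ContinuousAlternatingMap.compContinuousLinearMapCLM L)).contDiffAt.comp q hg
  exact (h3 _ h2).add (((h3 _ h1).sub (h3 _ h1)).sub (h3 _ h1))

theorem formLift_nondegenerate {s : E → E [⋀^Fin 2]→L[ℝ] ℝ} {q : E × E}
    (hs : ∀ v, (∀ w, s q.1 ![v, w] = 0) → v = 0) (a : E × E)
    (h : ∀ b, formLift s q ![a, b] = 0) : a = 0 := by
  have h0 (τ : E [⋀^Fin 2]→L[ℝ] ℝ) (v : E) : τ ![v, 0] = 0 := by rw [← toBilin_apply, map_zero]
  -- Vertical vectors `(0, w)` detect the base component, and horizontal ones the fibre component.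
  have h1 : a.1 = 0 := hs _ fun w ↦ by
    simpa [formLift_apply, h0] using h (0, w)
  have h2 : a.2 = 0 := hs _ fun w ↦ by
    have := h (w, 0)
    rw [formLift_apply, h1, ← toBilin_apply, ← toBilin_apply] at this
    simpa using this
  exact Prod.ext h1 h2

end VectorSpace

open Bundle

/-! ### Coordinate expressions on manifolds and tangent bundles -/

section Charts

variable {E : Type*} [NormedAddCommGroup E] [NormedSpace ℝ E]
  {H : Type*} [TopologicalSpace H] {I : ModelWithCorners ℝ E H}
  {N : Type*} [TopologicalSpace N] [ChartedSpace H N]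
  {E' : Type*} [NormedAddCommGroup E'] [NormedSpace ℝ E']
  {H' : Type*} [TopologicalSpace H'] {I' : ModelWithCorners ℝ E' H'}
  {N' : Type*} [TopologicalSpace N'] [ChartedSpace H' N']

variable (I) in
/-- The derivative at `y` of the inverse of the chart around `x₀`, which maps coordinates of a
tangent vector to the tangent vector. -/
def chartFrame (x₀ : N) (y : E) : E →L[ℝ] TangentSpace I ((extChartAt I x₀).symm y) :=
  mfderivWithin 𝓘(ℝ, E) I (extChartAt I x₀).symm (Set.range I) y

theorem chartForm_apply (Ω : TwoForm I N) (x₀ : N) (y v w : E) :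
    chartForm Ω x₀ y ![v, w] =
      Ω ((extChartAt I x₀).symm y) ![chartFrame I x₀ y v, chartFrame I x₀ y w] :=
  congrArg (Ω _) (comp_vec (chartFrame I x₀ y) v w)

/-- Two-forms at equal points agree on tangent vectors that are equal as elements of the model
space. -/
theorem twoForm_congr (Ω : TwoForm I N) {z z' : N} (hz : z = z') {a b : TangentSpace I z}
    {a' b' : TangentSpace I z'} (ha : (a : E) = a') (hb : (b : E) = b') :
    Ω z ![a, b] = Ω z' ![a', b'] := by
  subst hz; subst ha; subst hb; rfl

/-- The chart around `x` identifies the tangent space at `x` with `E` by the identity. -/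
theorem chartFrame_self [IsManifold I 1 N] (x : N) (v : E) :
    (chartFrame I x (extChartAt I x x) v : E) = v := by
  have h := mfderivWithin_range_extChartAt_symm (I := I) (x := x)
  exact DFunLike.congr_fun (F := E →L[ℝ] E) h v

theorem mdifferentiableAt_extChartAt_symm [I.Boundaryless] [IsManifold I 1 N] {x₀ : N} {y : E}
    (hy : y ∈ (extChartAt I x₀).target) :
    MDifferentiableAt 𝓘(ℝ, E) I (extChartAt I x₀).symm y := by
  have h := mdifferentiableWithinAt_extChartAt_symm (I := I) hy
  rwa [I.range_eq_univ, mdifferentiableWithinAt_univ] at h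

theorem chartFrame_eq_mfderiv [I.Boundaryless] (x₀ : N) (y : E) :
    chartFrame I x₀ y = mfderiv 𝓘(ℝ, E) I (extChartAt I x₀).symm y := by
  rw [chartFrame, I.range_eq_univ, mfderivWithin_univ]

variable (I I') in
/-- The coordinate expression of a map between manifolds, in the charts around `x₀` and `x₁`. -/
def localRep (F : N → N') (x₀ : N) (x₁ : N') (y : E) : E' :=
  extChartAt I' x₁ (F ((extChartAt I x₀).symm y))

theorem eventually_localRep [I.Boundaryless] {F : N → N'} {x₀ : N} {x₁ : N'}
    {y : E} (hy : y ∈ (extChartAt I x₀).target)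
    (hF : ContinuousAt F ((extChartAt I x₀).symm y))
    (hy' : F ((extChartAt I x₀).symm y) ∈ (extChartAt I' x₁).source) :
    ∀ᶠ z in 𝓝 y, z ∈ (extChartAt I x₀).target ∧
      F ((extChartAt I x₀).symm z) ∈ (extChartAt I' x₁).source := by
  refine Filter.Eventually.and ((isOpen_extChartAt_target x₀).mem_nhds hy) ?_
  have h := ContinuousAt.comp (f := (extChartAt I x₀).symm) hF (continuousAt_extChartAt_symm'' hy)
  exact h.eventually ((isOpen_extChartAt_source x₁).mem_nhds hy')

theorem localRep_mem_target {F : N → N'} {x₀ : N} {x₁ : N'} {y : E}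
    (hy' : F ((extChartAt I x₀).symm y) ∈ (extChartAt I' x₁).source) :
    localRep I I' F x₀ x₁ y ∈ (extChartAt I' x₁).target :=
  (extChartAt I' x₁).map_source hy'

theorem extChartAt_symm_localRep {F : N → N'} {x₀ : N} {x₁ : N'} {y : E}
    (hy' : F ((extChartAt I x₀).symm y) ∈ (extChartAt I' x₁).source) :
    (extChartAt I' x₁).symm (localRep I I' F x₀ x₁ y) = F ((extChartAt I x₀).symm y) :=
  (extChartAt I' x₁).left_inv hy'

theorem contDiffAt_localRep [I.Boundaryless] [IsManifold I ∞ N] [IsManifold I' ∞ N']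
    {F : N → N'} {x₀ : N} {x₁ : N'} {y : E} (hy : y ∈ (extChartAt I x₀).target)
    (hF : ContMDiffAt I I' ∞ F ((extChartAt I x₀).symm y))
    (hy' : F ((extChartAt I x₀).symm y) ∈ (extChartAt I' x₁).source) :
    ContDiffAt ℝ ∞ (localRep I I' F x₀ x₁) y := by
  rw [← contMDiffAt_iff_contDiffAt]
  have h1 : ContMDiffAt 𝓘(ℝ, E) I ∞ (extChartAt I x₀).symm y :=
    (contMDiffOn_extChartAt_symm x₀).contMDiffAt ((isOpen_extChartAt_target x₀).mem_nhds hy)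
  have h2 : ContMDiffAt I' 𝓘(ℝ, E') ∞ (extChartAt I' x₁) (F ((extChartAt I x₀).symm y)) :=
    contMDiffAt_extChartAt' (by rwa [← extChartAt_source I'])
  exact h2.comp y (hF.comp y h1)

/-- In coordinates, the tangent map is the derivative of the coordinate expression. -/
theorem chartFrame_fderiv_localRep [I.Boundaryless] [I'.Boundaryless]
    [IsManifold I ∞ N] [IsManifold I' ∞ N']
    {F : N → N'} {x₀ : N} {x₁ : N'} {y : E} (hy : y ∈ (extChartAt I x₀).target)
    (hF : ContMDiffAt I I' ∞ F ((extChartAt I x₀).symm y))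
    (hy' : F ((extChartAt I x₀).symm y) ∈ (extChartAt I' x₁).source) (v : E) :
    (chartFrame I' x₁ (localRep I I' F x₀ x₁ y) (fderiv ℝ (localRep I I' F x₀ x₁) y v) : E') =
      mfderiv I I' F ((extChartAt I x₀).symm y) (chartFrame I x₀ y v) := by
  rw [chartFrame_eq_mfderiv, chartFrame_eq_mfderiv]
  have h0 := (contDiffAt_localRep hy hF hy').differentiableAt (by simp)
  have h1 := mfderiv_comp y (hF.mdifferentiableAt (by simp)) (mdifferentiableAt_extChartAt_symm hy)
  have h2 := mfderiv_comp (g := (extChartAt I' x₁).symm) y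
    (mdifferentiableAt_extChartAt_symm (localRep_mem_target hy'))
    h0.mdifferentiableAt
  rw [mfderiv_eq_fderiv] at h2
  have h3 : (extChartAt I' x₁).symm ∘ localRep I I' F x₀ x₁ =ᶠ[𝓝 y] F ∘ (extChartAt I x₀).symm := by
    filter_upwards [eventually_localRep hy hF.continuousAt hy'] with z hz
    exact extChartAt_symm_localRep hz.2
  have h4 := h3.mfderiv_eq (I := 𝓘(ℝ, E)) (I' := I')
  rw [h1, h2] at h4
  exact DFunLike.congr_fun (F := E →L[ℝ] E') h4 v

/-- The coordinate expression of a pullback is the pullback of the coordinate expression. -/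
theorem chartForm_pullback [I.Boundaryless] [I'.Boundaryless]
    [IsManifold I ∞ N] [IsManifold I' ∞ N'] {Ω : TwoForm I N} {Ω' : TwoForm I' N'}
    {F : N → N'} (hΩ : ∀ (x : N) (v w : TangentSpace I x),
      Ω' (F x) ![mfderiv I I' F x v, mfderiv I I' F x w] = Ω x ![v, w])
    {x₀ : N} {x₁ : N'} {y : E} (hy : y ∈ (extChartAt I x₀).target)
    (hF : ContMDiffAt I I' ∞ F ((extChartAt I x₀).symm y))
    (hy' : F ((extChartAt I x₀).symm y) ∈ (extChartAt I' x₁).source) :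
    chartForm Ω x₀ y = (chartForm Ω' x₁ (localRep I I' F x₀ x₁ y)).compContinuousLinearMap
      (fderiv ℝ (localRep I I' F x₀ x₁) y) := by
  have h (c : Fin 2 → E) : c = ![c 0, c 1] := by
    ext i; fin_cases i <;> rfl
  ext c
  rw [h c, ContinuousAlternatingMap.compContinuousLinearMap_apply, comp_vec, chartForm_apply,
    chartForm_apply, ← hΩ]
  exact twoForm_congr Ω' (extChartAt_symm_localRep hy').symm
    (chartFrame_fderiv_localRep hy hF hy' _).symm (chartFrame_fderiv_localRep hy hF hy' _).symm

section TangentBundle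
variable [IsManifold I 1 N] [IsManifold I' 1 N']

theorem tangent_extChartAt_target (p : TangentBundle I N) :
    (extChartAt I.tangent p).target = (extChartAt I p.proj).target ×ˢ Set.univ := by
  rw [FiberBundle.extChartAt_target]
  congr 1
  rw [TangentBundle.trivializationAt_baseSet, Set.inter_eq_left]
  intro y hy
  have := (extChartAt I p.proj).map_target hy
  rwa [extChartAt_source] at this

theorem tangent_extChartAt_source (p q : TangentBundle I N) :
    q ∈ (extChartAt I.tangent p).source ↔ q.proj ∈ (extChartAt I p.proj).source := by
  rw [extChartAt_source, extChartAt_source]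
  exact TangentBundle.mem_chart_source_iff q p

theorem tangent_extChartAt_apply {p q : TangentBundle I N}
    (hq : q.proj ∈ (extChartAt I p.proj).source) :
    extChartAt I.tangent p q = (extChartAt I p.proj q.proj,
      (mfderiv I 𝓘(ℝ, E) (extChartAt I p.proj) q.proj q.snd : E)) := by
  rw [extChartAt_source] at hq
  rw [← TangentBundle.continuousLinearMapAt_trivializationAt hq,
    TangentBundle.continuousLinearMapAt_trivializationAt_eq_core hq, FiberBundle.extChartAt]
  rfl

/-- The fibre coordinate in the chart centred at `p` is the vector of `p` itself, as an element of
the model space. -/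
theorem tangent_extChartAt_self (p : TangentBundle I N) :
    extChartAt I.tangent p p = (extChartAt I p.proj p.proj, p.snd) := by
  rw [tangent_extChartAt_apply (mem_extChartAt_source _), mfderiv_extChartAt_self]
  rfl

theorem tangent_extChartAt_symm {p : TangentBundle I N} {y v : E}
    (hy : y ∈ (extChartAt I p.proj).target) :
    (extChartAt I.tangent p).symm (y, v) =
      ⟨(extChartAt I p.proj).symm y, chartFrame I p.proj y v⟩ := by
  have hs : (⟨(extChartAt I p.proj).symm y, chartFrame I p.proj y v⟩ : TangentBundle I N) ∈
      (extChartAt I.tangent p).source :=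
    (tangent_extChartAt_source _ _).2 ((extChartAt I p.proj).map_target hy)
  rw [← (extChartAt I.tangent p).left_inv hs,
    tangent_extChartAt_apply ((extChartAt I p.proj).map_target hy)]
  congr 2
  · exact ((extChartAt I p.proj).right_inv hy).symm
  · have h := mfderiv_extChartAt_comp_mfderivWithin_extChartAt_symm hy
    exact (DFunLike.congr_fun (F := E →L[ℝ] E) h v).symm

end TangentBundle

/-- The coordinate expression of the tangent map in the induced charts is the tangent map of the
coordinate expression. -/
theorem localRep_tangentMap [I.Boundaryless] [I'.Boundaryless]
    [IsManifold I ∞ N] [IsManifold I' ∞ N']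
    {F : N → N'} {p : TangentBundle I N} {p' : TangentBundle I' N'} {q : E × E}
    (hy : q.1 ∈ (extChartAt I p.proj).target)
    (hF : ContMDiffAt I I' ∞ F ((extChartAt I p.proj).symm q.1))
    (hy' : F ((extChartAt I p.proj).symm q.1) ∈ (extChartAt I' p'.proj).source) :
    localRep I.tangent I'.tangent (tangentMap I I' F) p p' q =
      tangentRep (localRep I I' F p.proj p'.proj) q := by
  obtain ⟨y, v⟩ := q
  rw [localRep, tangent_extChartAt_symm hy]
  have h : tangentMap I I' F ⟨(extChartAt I p.proj).symm y, chartFrame I p.proj y v⟩ =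
      (extChartAt I'.tangent p').symm (tangentRep (localRep I I' F p.proj p'.proj) (y, v)) := by
    rw [tangentRep, tangent_extChartAt_symm (localRep_mem_target hy')]
    refine TotalSpace.ext (extChartAt_symm_localRep hy').symm (heq_of_eq ?_)
    exact (chartFrame_fderiv_localRep hy hF hy' v).symm
  rw [h, (extChartAt I'.tangent p').right_inv]
  rw [tangent_extChartAt_target]
  exact ⟨localRep_mem_target hy', trivial⟩

end Charts

/-! ### The complete lift of a symplectic form -/

section CompleteLift

variable {E : Type*} [NormedAddCommGroup E] [NormedSpace ℝ E]
  {H : Type*} [TopologicalSpace H] {I : ModelWithCorners ℝ E H} [I.Boundaryless]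
  {N : Type*} [TopologicalSpace N] [ChartedSpace H N]
  {E' : Type*} [NormedAddCommGroup E'] [NormedSpace ℝ E']
  {H' : Type*} [TopologicalSpace H'] {I' : ModelWithCorners ℝ E' H'} [I'.Boundaryless]
  {N' : Type*} [TopologicalSpace N'] [ChartedSpace H' N']

omit [I'.Boundaryless] in
/-- At the centres of the charts, the derivative is the derivative of the coordinate expression,
without any change of frame. -/
theorem mfderiv_apply_eq_fderiv_localRep {F : N → N'} {x : N} (hF : MDifferentiableAt I I' F x)
    (v : TangentSpace I x) : (mfderiv I I' F x v : E') =
      fderiv ℝ (localRep I I' F x (F x)) (extChartAt I x x) v := by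
  rw [hF.mfderiv, I.range_eq_univ, fderivWithin_univ]
  rfl

namespace IsSymplecticForm

theorem contDiffAt_chartForm {Ω : TwoForm I N} (hΩ : IsSymplecticForm Ω) {x₀ : N} {y : E}
    (hy : y ∈ (extChartAt I x₀).target) : ContDiffAt ℝ ∞ (chartForm Ω x₀) y :=
  (hΩ.smooth x₀).contDiffAt ((isOpen_extChartAt_target x₀).mem_nhds hy)

theorem extDeriv_chartForm {Ω : TwoForm I N} (hΩ : IsSymplecticForm Ω) {x₀ : N} {y : E}
    (hy : y ∈ (extChartAt I x₀).target) : extDeriv (chartForm Ω x₀) y = 0 := by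
  have h := hΩ.closed x₀ y hy
  rwa [I.range_eq_univ, extDerivWithin_univ] at h

omit [I.Boundaryless] in
theorem chartForm_nondegenerate [IsManifold I 1 N] {Ω : TwoForm I N} (hΩ : IsSymplecticForm Ω)
    {x₀ : N} {y : E} (hy : y ∈ (extChartAt I x₀).target) (v : E)
    (h : ∀ w, chartForm Ω x₀ y ![v, w] = 0) : v = 0 := by
  have hi : (chartFrame I x₀ y).IsInvertible := isInvertible_mfderivWithin_extChartAt_symm hy
  obtain ⟨L, hL⟩ := hi
  have h0 : chartFrame I x₀ y v = 0 := by
    refine hΩ.nondegenerate _ _ fun w ↦ ?_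
    rw [← L.apply_symm_apply w, ← h (L.symm w), chartForm_apply, ← hL]
    rfl
  rw [← hL] at h0
  exact L.injective (h0.trans (map_zero L).symm)

end IsSymplecticForm

/-- The complete lift at `p`, in terms of the chart centred at `p`; the tangent space of the tangent
bundle at `p` is `E × E` by definition. -/
theorem completeLift_eq_formLift [IsManifold I 1 N] (Ω : TwoForm I N) (p : TangentBundle I N) :
    completeLift Ω p = formLift (chartForm Ω p.proj) (extChartAt I.tangent p p) := by
  have h : fderivWithin ℝ (chartForm Ω p.proj) (Set.range I) = fderiv ℝ (chartForm Ω p.proj) := by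
    rw [I.range_eq_univ, fderivWithin_univ]
  rw [completeLift, h, tangent_extChartAt_self]
  rfl

variable [IsManifold I ∞ N] [IsManifold I' ∞ N']

/-- The complete lift of symplectic forms is natural with respect to symplectic maps, in
coordinates. -/
theorem formLift_chartForm_pullback {Ω : TwoForm I N} {Ω' : TwoForm I' N'}
    (hΩ : IsSymplecticForm Ω) (hΩ' : IsSymplecticForm Ω') {F : N → N'} (hF : ContMDiff I I' ∞ F)
    (h : ∀ (x : N) (v w : TangentSpace I x),
      Ω' (F x) ![mfderiv I I' F x v, mfderiv I I' F x w] = Ω x ![v, w])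
    {x₀ : N} {x₁ : N'} {q : E × E} (hy : q.1 ∈ (extChartAt I x₀).target)
    (hy' : F ((extChartAt I x₀).symm q.1) ∈ (extChartAt I' x₁).source) :
    formLift (chartForm Ω x₀) q =
      (formLift (chartForm Ω' x₁) (tangentRep (localRep I I' F x₀ x₁) q)).compContinuousLinearMap
        (fderiv ℝ (tangentRep (localRep I I' F x₀ x₁)) q) := by
  refine formLift_pullback (contDiffAt_localRep hy hF.contMDiffAt hy')
    (hΩ'.contDiffAt_chartForm (localRep_mem_target hy'))
    ((hΩ.contDiffAt_chartForm hy).differentiableAt (by simp)) (hΩ.extDeriv_chartForm hy)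
    (hΩ'.extDeriv_chartForm (localRep_mem_target hy')) ?_
  filter_upwards [eventually_localRep hy hF.continuous.continuousAt hy'] with z hz
  exact chartForm_pullback h hz.1 hF.contMDiffAt hz.2

theorem eventuallyEq_localRep_tangentMap {F : N → N'} (hF : ContMDiff I I' ∞ F)
    {p : TangentBundle I N} {p' : TangentBundle I' N'} {q : E × E}
    (hy : q.1 ∈ (extChartAt I p.proj).target)
    (hy' : F ((extChartAt I p.proj).symm q.1) ∈ (extChartAt I' p'.proj).source) :
    localRep I.tangent I'.tangent (tangentMap I I' F) p p' =ᶠ[𝓝 q]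
      tangentRep (localRep I I' F p.proj p'.proj) := by
  filter_upwards [continuousAt_fst.eventually
    (eventually_localRep hy hF.continuous.continuousAt hy')] with z hz
  exact localRep_tangentMap hz.1 hF.contMDiffAt hz.2

/-- The coordinate expression of the complete lift in every chart, not only at its centre. -/
theorem chartForm_completeLift {Ω : TwoForm I N} (hΩ : IsSymplecticForm Ω) (p₀ : TangentBundle I N)
    {q : E × E} (hq : q ∈ (extChartAt I.tangent p₀).target) :
    (chartForm (completeLift Ω) p₀ q : (E × E) [⋀^Fin 2]→L[ℝ] ℝ) =
      formLift (chartForm Ω p₀.proj) q := by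
  have hy : q.1 ∈ (extChartAt I p₀.proj).target := by
    rw [tangent_extChartAt_target] at hq
    exact hq.1
  -- The definition of the complete lift at `p` uses the chart centred at `p`; the comparison with
  -- the chart around `p₀` is naturality for the identity map, read in these two charts.
  set p := (extChartAt I.tangent p₀).symm q with hp
  have hp' : p = ⟨(extChartAt I p₀.proj).symm q.1, chartFrame I p₀.proj q.1 q.2⟩ :=
    tangent_extChartAt_symm hy
  have hpp : p.proj = (extChartAt I p₀.proj).symm q.1 := by rw [hp']
  have hs : id ((extChartAt I p₀.proj).symm q.1) ∈ (extChartAt I p.proj).source := by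
    rw [hpp]; exact mem_extChartAt_source _
  have hev := eventuallyEq_localRep_tangentMap (F := id) (p := p₀) (p' := p) contMDiff_id hy hs
  rw [tangentMap_id] at hev
  have hfr (a : E × E) : (chartFrame I.tangent p₀ q a : E × E) =
      fderiv ℝ (tangentRep (localRep I I id p₀.proj p.proj)) q a := by
    have h := chartFrame_fderiv_localRep (F := id) (x₀ := p₀) (x₁ := p) hq contMDiffAt_id
      (mem_extChartAt_source p) a
    rw [mfderiv_id, localRep, id, ← hp, chartFrame_self, hev.fderiv_eq] at h
    exact h.symm
  have hval : tangentRep (localRep I I id p₀.proj p.proj) q =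
      extChartAt I.tangent p p := hev.self_of_nhds.symm
  have hpull := formLift_chartForm_pullback (F := id) (x₁ := p.proj) hΩ hΩ contMDiff_id
    (fun x v w ↦ by rw [mfderiv_id]; rfl) hy hs
  rw [hval, ← completeLift_eq_formLift] at hpull
  rw [hpull]
  ext c
  change completeLift Ω p _ = completeLift Ω p _
  congr 1
  funext i
  exact hfr (c i)

theorem IsSymplecticForm.completeLift {Ω : TwoForm I N} (hΩ : IsSymplecticForm Ω) :
    IsSymplecticForm (completeLift Ω) where
  smooth p₀ := by
    refine ContDiffOn.congr (f := formLift (chartForm Ω p₀.proj)) ?_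
      fun q hq ↦ chartForm_completeLift hΩ p₀ hq
    intro q hq
    rw [tangent_extChartAt_target] at hq
    exact (contDiffAt_formLift (hΩ.contDiffAt_chartForm hq.1)).contDiffWithinAt
  closed p₀ q hq := by
    rw [I.tangent.range_eq_univ, extDerivWithin_univ]
    have hy (z : E × E) (hz : z ∈ (extChartAt I.tangent p₀).target) :
        z.1 ∈ (extChartAt I p₀.proj).target := by
      rw [tangent_extChartAt_target] at hz
      exact hz.1
    have h : chartForm (TangentReduction.completeLift Ω) p₀ =ᶠ[𝓝 q]
        extDeriv (tautForm (chartForm Ω p₀.proj)) := by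
      filter_upwards [(isOpen_extChartAt_target p₀).mem_nhds hq] with z hz
      rw [extDeriv_tautForm ((hΩ.contDiffAt_chartForm (hy z hz)).differentiableAt (by simp))
        (hΩ.extDeriv_chartForm (hy z hz))]
      exact chartForm_completeLift hΩ p₀ hz
    rw [h.extDeriv_eq]
    exact extDeriv_extDeriv_apply (contDiffAt_tautForm (hΩ.contDiffAt_chartForm (hy q hq)))
      (by simp; exact two_le_infty)
  nondegenerate p v h := by
    refine formLift_nondegenerate (s := chartForm Ω p.proj) (q := extChartAt I.tangent p p)
      (hΩ.chartForm_nondegenerate (x₀ := p.proj) ?_) v fun b ↦ ?_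
    · rw [tangent_extChartAt_self]
      exact mem_extChartAt_target p.proj
    rw [← completeLift_eq_formLift]
    exact h b

/-- The tangent map of a symplectic map preserves the complete lifts. -/
theorem completeLift_tangentMap {Ω : TwoForm I N} {Ω' : TwoForm I' N'}
    (hΩ : IsSymplecticForm Ω) (hΩ' : IsSymplecticForm Ω') {F : N → N'} (hF : ContMDiff I I' ∞ F)
    (h : ∀ (x : N) (v w : TangentSpace I x),
      Ω' (F x) ![mfderiv I I' F x v, mfderiv I I' F x w] = Ω x ![v, w])
    (p : TangentBundle I N) (a b : TangentSpace I.tangent p) :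
    completeLift Ω' (tangentMap I I' F p)
      ![mfderiv I.tangent I'.tangent (tangentMap I I' F) p a,
        mfderiv I.tangent I'.tangent (tangentMap I I' F) p b] = completeLift Ω p ![a, b] := by
  set q : E × E := extChartAt I.tangent p p with hq
  have hq1 : q.1 = extChartAt I p.proj p.proj := by rw [hq, tangent_extChartAt_self]
  have hy : q.1 ∈ (extChartAt I p.proj).target := hq1 ▸ mem_extChartAt_target p.proj
  have hy' : F ((extChartAt I p.proj).symm q.1) ∈
      (extChartAt I' (tangentMap I I' F p).proj).source := by
    rw [hq1, (extChartAt I p.proj).left_inv (mem_extChartAt_source _)]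
    exact mem_extChartAt_source (I := I') (F p.proj)
  have hev := eventuallyEq_localRep_tangentMap (p' := tangentMap I I' F p) hF hy hy'
  have hval : tangentRep (localRep I I' F p.proj (tangentMap I I' F p).proj) q =
      extChartAt I'.tangent (tangentMap I I' F p) (tangentMap I I' F p) := by
    rw [← hev.self_of_nhds, localRep, (extChartAt I.tangent p).left_inv (mem_extChartAt_source _)]
  have hT : MDifferentiableAt I.tangent I'.tangent (tangentMap I I' F) p :=
    (hF.contMDiff_tangentMap (m := 1) two_le_infty).mdifferentiable (by simp) p
  have hfr (a : E × E) : (mfderiv I.tangent I'.tangent (tangentMap I I' F) p a : E' × E') =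
      fderiv ℝ (tangentRep (localRep I I' F p.proj (tangentMap I I' F p).proj)) q a := by
    rw [← hev.fderiv_eq]
    exact mfderiv_apply_eq_fderiv_localRep hT a
  have hpull := formLift_chartForm_pullback hΩ hΩ' hF h hy hy'
  rw [hval, ← completeLift_eq_formLift, ← completeLift_eq_formLift] at hpull
  rw [hpull]
  change completeLift Ω' _ _ = completeLift Ω' _ _
  congr 1
  funext i
  fin_cases i
  · exact hfr a
  · exact hfr b

end CompleteLift

/-! ### The isomorphism between the tangent and the cotangent bundle -/

section Flat

variable {E : Type*} [NormedAddCommGroup E] [NormedSpace ℝ E]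
  {H : Type*} [TopologicalSpace H] {I : ModelWithCorners ℝ E H}
  {N : Type*} [TopologicalSpace N] [ChartedSpace H N]

/-- A nondegenerate alternating bilinear form on a finite-dimensional space identifies the space
with its dual. -/
theorem exists_equiv_dual [FiniteDimensional ℝ E] (τ : E [⋀^Fin 2]→L[ℝ] ℝ)
    (hτ : ∀ v, (∀ w, τ ![v, w] = 0) → v = 0) :
    ∃ L : E ≃L[ℝ] (E →L[ℝ] ℝ), (L : E →L[ℝ] E →L[ℝ] ℝ) = toBilin E τ := by
  have hinj : Function.Injective (toBilin E τ).toLinearMap := by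
    rw [← LinearMap.ker_eq_bot, LinearMap.ker_eq_bot']
    intro v hv
    refine hτ v fun w ↦ ?_
    rw [← toBilin_apply]
    exact DFunLike.congr_fun hv w
  have hdim : Module.finrank ℝ E = Module.finrank ℝ (E →L[ℝ] ℝ) := by
    rw [← (LinearMap.toContinuousLinearMap (E := E) (F' := ℝ) (𝕜 := ℝ)).finrank_eq]
    exact Subspace.dual_finrank_eq.symm
  refine ⟨(LinearEquiv.ofInjectiveOfFinrankEq _ hinj hdim).toContinuousLinearEquiv, ?_⟩
  ext v w
  rfl

theorem IsSymplecticForm.exists_flat_equiv [FiniteDimensional ℝ E] {Ω : TwoForm I N}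
    (hΩ : IsSymplecticForm Ω) (x : N) :
    ∃ L : TangentSpace I x ≃L[ℝ] (TangentSpace I x →L[ℝ] ℝ),
      ∀ v : TangentSpace I x, flat Ω ⟨x, v⟩ = ⟨x, L v⟩ := by
  obtain ⟨L, hL⟩ := exists_equiv_dual (E := E) (Ω x) (hΩ.nondegenerate x)
  refine ⟨L, fun v ↦ TotalSpace.ext rfl (heq_of_eq ?_)⟩
  ext w
  refine (flat_apply Ω x v w).trans ((toBilin_apply (E := E) (Ω x) v w).symm.trans ?_)
  rw [← hL]
  rfl

theorem IsSymplecticForm.flat_bijective [FiniteDimensional ℝ E] {Ω : TwoForm I N}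
    (hΩ : IsSymplecticForm Ω) : Function.Bijective (flat Ω) := by
  choose L hL using hΩ.exists_flat_equiv
  constructor
  · rintro ⟨x, v⟩ ⟨x', v'⟩ h
    obtain rfl : x = x' := congrArg TotalSpace.proj h
    rw [hL, hL] at h
    exact congrArg _ ((L x).injective (TotalSpace.mk_injective x h))
  · rintro ⟨x, α⟩
    exact ⟨⟨x, (L x).symm α⟩, by rw [hL, ContinuousLinearEquiv.apply_symm_apply]⟩

/-- The bijection `b_Ω` from the tangent to the cotangent bundle. -/
def IsSymplecticForm.flatEquiv [FiniteDimensional ℝ E] {Ω : TwoForm I N}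
    (hΩ : IsSymplecticForm Ω) : TangentBundle I N ≃ CotangentBundle I N :=
  Equiv.ofBijective (flat Ω) hΩ.flat_bijective

/-- The coordinate expression of a two-form, in terms of the trivialisation of the tangent
bundle. -/
theorem chartForm_extChartAt_apply [IsManifold I 1 N] (Ω : TwoForm I N) {x₀ x : N}
    (hx : x ∈ (chartAt H x₀).source) (v w : E) :
    chartForm Ω x₀ (extChartAt I x₀ x) ![v, w] =
      Ω x ![(trivializationAt E (TangentSpace I) x₀).symmL ℝ x v,
        (trivializationAt E (TangentSpace I) x₀).symmL ℝ x w] := by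
  rw [chartForm_apply]
  have h := TangentBundle.symmL_trivializationAt (I := I) hx
  refine twoForm_congr Ω ((extChartAt I x₀).left_inv (by rwa [extChartAt_source])) ?_ ?_
  · rw [h]; rfl
  · rw [h]; rfl

/-- The fibre coordinate of a covector, in the trivialisation of the cotangent bundle around
`x₀`. -/
def covectorCoord [IsManifold I 1 N] (x₀ : N) (α : CotangentBundle I N) : E →L[ℝ] ℝ :=
  α.snd ∘L (trivializationAt E (TangentSpace I) x₀).symmL ℝ α.proj

/-- A map into the cotangent bundle is smooth if and only if its base point and its fibre
coordinate are. -/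
theorem contMDiffAt_cotangentBundle [IsManifold I 1 N] {n : WithTop ℕ∞}
    {EP : Type*} [NormedAddCommGroup EP] [NormedSpace ℝ EP]
    {HP : Type*} [TopologicalSpace HP] {IP : ModelWithCorners ℝ EP HP}
    {P : Type*} [TopologicalSpace P] [ChartedSpace HP P]
    (f : P → CotangentBundle I N) {p₀ : P} :
    ContMDiffAt IP (I.prod 𝓘(ℝ, E →L[ℝ] ℝ)) n f p₀ ↔
      ContMDiffAt IP I n (fun p ↦ (f p).proj) p₀ ∧
        ContMDiffAt IP 𝓘(ℝ, E →L[ℝ] ℝ) n (fun p ↦ covectorCoord (f p₀).proj (f p)) p₀ := by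
  have h (p : P) : covectorCoord (f p₀).proj (f p) =
      ContinuousLinearMap.inCoordinates E (TangentSpace I) ℝ (Bundle.Trivial N ℝ)
        (f p₀).proj (f p).proj (f p₀).proj (f p).proj (f p).snd := by
    rw [ContinuousLinearMap.inCoordinates]
    ext v
    simp [covectorCoord]
  simp only [h]
  exact contMDiffAt_hom_bundle f

/-- In coordinates, `b_Ω` is the family of linear maps given by the coordinate expression
of `Ω`. -/
theorem covectorCoord_flat [IsManifold I 1 N] (Ω : TwoForm I N) {x₀ : N} {p : TangentBundle I N}
    (hp : p.proj ∈ (chartAt H x₀).source) :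
    covectorCoord x₀ (flat Ω p) = toBilin E (chartForm Ω x₀ (extChartAt I x₀ p.proj))
      (trivializationAt E (TangentSpace I) x₀ p).2 := by
  ext w
  rw [toBilin_apply, chartForm_extChartAt_apply Ω hp]
  have h : (trivializationAt E (TangentSpace I) x₀).symmL ℝ p.proj
      (trivializationAt E (TangentSpace I) x₀ p).2 = p.snd := by
    rw [Trivialization.symmL_apply (R := ℝ) (hb := hp)]
    exact (trivializationAt E (TangentSpace I) x₀).symm_apply_apply_mk hp p.snd
  rw [h, ← flat_apply]
  rfl

variable [I.Boundaryless] [IsManifold I ∞ N]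

omit [IsManifold I ∞ N] in
theorem IsSymplecticForm.contMDiffAt_toBilin {Ω : TwoForm I N} (hΩ : IsSymplecticForm Ω) (x₀ : N) :
    ContMDiffAt I 𝓘(ℝ, E →L[ℝ] E →L[ℝ] ℝ) ∞
      (fun x ↦ toBilin E (chartForm Ω x₀ (extChartAt I x₀ x))) x₀ := by
  have h1 : ContDiffAt ℝ ∞ (fun y ↦ toBilin E (chartForm Ω x₀ y)) (extChartAt I x₀ x₀) :=
    (contDiff_toBilin E).contDiffAt.comp _ (hΩ.contDiffAt_chartForm (mem_extChartAt_target x₀))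
  exact h1.contMDiffAt.comp x₀ contMDiffAt_extChartAt

theorem IsSymplecticForm.contMDiff_flat {Ω : TwoForm I N} (hΩ : IsSymplecticForm Ω) :
    ContMDiff I.tangent (I.prod 𝓘(ℝ, E →L[ℝ] ℝ)) ∞ (flat Ω) := by
  intro p₀
  rw [contMDiffAt_cotangentBundle]
  refine ⟨contMDiffAt_proj (TangentSpace I), ?_⟩
  have h1 := (hΩ.contMDiffAt_toBilin p₀.proj).comp p₀ (contMDiffAt_proj (TangentSpace I))
  have h2 := (contMDiffAt_totalSpace.1 (contMDiffAt_id (I := I.tangent) (n := ∞) (x := p₀))).2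
  refine (h1.clm_apply h2).congr_of_eventuallyEq ?_
  filter_upwards [(FiberBundle.continuous_proj E (TangentSpace I)).continuousAt.eventually
    ((chartAt H p₀.proj).open_source.mem_nhds (mem_chart_source H p₀.proj))] with p hp
  exact covectorCoord_flat Ω hp

/-- The inverse of `b_Ω` is smooth: in coordinates it is the family of inverses of smoothly varying
invertible linear maps. -/
theorem IsSymplecticForm.contMDiff_flatEquiv_symm [FiniteDimensional ℝ E] {Ω : TwoForm I N}
    (hΩ : IsSymplecticForm Ω) :
    ContMDiff (I.prod 𝓘(ℝ, E →L[ℝ] ℝ)) I.tangent ∞ hΩ.flatEquiv.symm := by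
  have hproj (α : CotangentBundle I N) : (hΩ.flatEquiv.symm α).proj = α.proj :=
    congrArg TotalSpace.proj (hΩ.flatEquiv.apply_symm_apply α)
  have hflat (α : CotangentBundle I N) : flat Ω (hΩ.flatEquiv.symm α) = α :=
    hΩ.flatEquiv.apply_symm_apply α
  intro α₀
  rw [contMDiffAt_totalSpace]
  have hp : ContMDiffAt (I.prod 𝓘(ℝ, E →L[ℝ] ℝ)) I ∞ (TotalSpace.proj : CotangentBundle I N → N)
      α₀ := ((contMDiffAt_cotangentBundle id).1 contMDiffAt_id).1
  refine ⟨by simpa only [hproj] using hp, ?_⟩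
  simp only [hproj]
  set x₀ := α₀.proj
  have hinv (x : N) (hx : x ∈ (chartAt H x₀).source) :
      ∃ L : E ≃L[ℝ] (E →L[ℝ] ℝ), (L : E →L[ℝ] E →L[ℝ] ℝ) =
        toBilin E (chartForm Ω x₀ (extChartAt I x₀ x)) :=
    exists_equiv_dual _ (hΩ.chartForm_nondegenerate ((extChartAt I x₀).map_source
      (by rwa [extChartAt_source])))
  have h0 : ContMDiffAt (I.prod 𝓘(ℝ, E →L[ℝ] ℝ)) 𝓘(ℝ, (E →L[ℝ] ℝ) →L[ℝ] E) ∞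
      (fun α : CotangentBundle I N ↦
        (toBilin E (chartForm Ω x₀ (extChartAt I x₀ α.proj))).inverse) α₀ := by
    obtain ⟨L, hL⟩ := hinv x₀ (mem_chart_source H x₀)
    have : CompleteSpace E := FiniteDimensional.complete ℝ E
    have hi : ContDiffAt ℝ ∞ ContinuousLinearMap.inverse
        (toBilin E (chartForm Ω x₀ (extChartAt I x₀ x₀))) := by
      rw [← hL]
      exact contDiffAt_map_inverse L
    exact hi.contMDiffAt.comp α₀ ((hΩ.contMDiffAt_toBilin x₀).comp α₀ hp)
  have h1 := ((contMDiffAt_cotangentBundle (n := ∞) id).1 (contMDiffAt_id (x := α₀))).2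
  refine (h0.clm_apply h1).congr_of_eventuallyEq ?_
  filter_upwards [hp.continuousAt.eventually
    ((chartAt H x₀).open_source.mem_nhds (mem_chart_source H x₀))] with α hα
  have h2 := covectorCoord_flat Ω (p := hΩ.flatEquiv.symm α) (by rwa [hproj])
  rw [hflat, hproj] at h2
  obtain ⟨L, hL⟩ := hinv _ hα
  rw [id, id, h2, ← hL, ContinuousLinearMap.inverse_equiv]
  exact (L.symm_apply_apply _).symm

/-- `b_Ω` is a diffeomorphism from the tangent to the cotangent bundle. -/
def IsSymplecticForm.flatDiffeomorph [FiniteDimensional ℝ E] {Ω : TwoForm I N}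
    (hΩ : IsSymplecticForm Ω) :
    Diffeomorph I.tangent (I.prod 𝓘(ℝ, E →L[ℝ] ℝ)) (TangentBundle I N) (CotangentBundle I N) ∞ where
  toEquiv := hΩ.flatEquiv
  contMDiff_toFun := hΩ.contMDiff_flat
  contMDiff_invFun := hΩ.contMDiff_flatEquiv_symm

end Flat

section Actions

variable {EG : Type*} [NormedAddCommGroup EG] [NormedSpace ℝ EG]
  {HG : Type*} [TopologicalSpace HG] {IG : ModelWithCorners ℝ EG HG}
  {G : Type*} [TopologicalSpace G] [ChartedSpace HG G] [Group G]
  {E : Type*} [NormedAddCommGroup E] [NormedSpace ℝ E]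
  {H : Type*} [TopologicalSpace H] {I : ModelWithCorners ℝ E H}
  {N : Type*} [TopologicalSpace N] [ChartedSpace H N] {φ : G → N → N}

namespace IsSmoothAction

theorem contMDiff_act (hφ : IsSmoothAction IG I φ) (g : G) : ContMDiff I I ∞ (φ g) :=
  hφ.smooth.comp (contMDiff_const.prodMk contMDiff_id)

theorem contMDiff_orbit (hφ : IsSmoothAction IG I φ) (x : N) :
    ContMDiff IG I ∞ (fun g ↦ φ g x) :=
  hφ.smooth.comp (contMDiff_id.prodMk contMDiff_const)

variable [IsManifold IG ∞ G] [IsManifold I ∞ N]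

/-- The tangent lift of a smooth action is a smooth action. It is the tangent map of
`G × N → N`, restricted along the zero section of the tangent bundle of `G`. -/
theorem tangentLift (hφ : IsSmoothAction IG I φ) :
    IsSmoothAction IG I.tangent (tangentLift I φ) where
  one_act p := by
    have h : φ 1 = id := funext hφ.one_act
    rw [TangentReduction.tangentLift, h, tangentMap_id]
    rfl
  mul_act g h p := by
    have hgh : φ (g * h) = φ g ∘ φ h := funext (hφ.mul_act g h)
    rw [TangentReduction.tangentLift, hgh]
    exact tangentMap_comp_at p ((hφ.contMDiff_act g).mdifferentiable (by simp) _)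
      ((hφ.contMDiff_act h).mdifferentiable (by simp) _)
  smooth := by
    have h1 : ContMDiff (IG.prod I.tangent) (IG.prod I).tangent ∞ (fun p : G × TangentBundle I N ↦
        (equivTangentBundleProd IG G I N).symm (zeroSection EG (TangentSpace IG) p.1, p.2)) :=
      contMDiff_equivTangentBundleProd_symm.comp
        (((contMDiff_zeroSection ℝ (TangentSpace IG)).comp contMDiff_fst).prodMk contMDiff_snd)
    have h2 := (hφ.smooth.contMDiff_tangentMap (m := ∞) (by simp)).comp h1
    convert h2 using 1
    funext ⟨g, p⟩
    have hm := hφ.smooth.mdifferentiable (by simp) (g, p.proj)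
    have hg : MDifferentiableAt I (IG.prod I) (fun x : N ↦ (g, x)) p.proj :=
      mdifferentiableAt_const.prodMk mdifferentiableAt_id
    have hc := mfderiv_comp p.proj hm hg
    refine TotalSpace.ext rfl (heq_of_eq ?_)
    change mfderiv I I (φ g) p.proj p.snd = _
    have hd : mfderiv I (IG.prod I) (fun x : N ↦ (g, x)) p.proj p.snd = ((0 : EG), p.snd) := by
      have h := mfderiv_prodMk (I := I) (I' := IG) (I'' := I) (f := fun _ : N ↦ g) (g := fun x ↦ x)
        (x := p.proj) mdifferentiableAt_const mdifferentiableAt_id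
      have h' := DFunLike.congr_fun h p.snd
      refine h'.trans ?_
      have hc0 := mfderiv_const (I := I) (I' := IG) (c := g) (x := p.proj)
      have hi := mfderiv_id (I := I) (x := p.proj)
      exact Prod.ext (DFunLike.congr_fun hc0 p.snd) (DFunLike.congr_fun hi p.snd)
    have hc' := DFunLike.congr_fun hc p.snd
    refine Eq.trans hc' ?_
    rw [ContinuousLinearMap.comp_apply, hd]
    rfl

end IsSmoothAction

end Actions

/-! ### Momentum maps of lifted actions -/

section Calculus

variable {E : Type*} [NormedAddCommGroup E] [NormedSpace ℝ E]
  {F : Type*} [NormedAddCommGroup F] [NormedSpace ℝ F]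

theorem fderiv_fderiv_apply_prod {h : E → ℝ} {y v : E} (hh : ContDiffAt ℝ 2 h y) (b : E × E) :
    fderiv ℝ (fun q : E × E ↦ fderiv ℝ h q.1 q.2) (y, v) b =
      fderiv ℝ (fderiv ℝ h) y b.1 v + fderiv ℝ h y b.2 := by
  have h1 : HasFDerivAt (fun q : E × E ↦ fderiv ℝ h q.1)
      (fderiv ℝ (fderiv ℝ h) y ∘L ContinuousLinearMap.fst ℝ E E) (y, v) :=
    HasFDerivAt.comp (g := fderiv ℝ h) (y, v)
      ((hh.fderiv_right (m := 1) (by norm_num)).differentiableAt (by simp)).hasFDerivAt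
      (hasFDerivAt_fst (𝕜 := ℝ) (E := E) (F := E) (p := (y, v)))
  have h2 := h1.clm_apply (hasFDerivAt_snd (𝕜 := ℝ) (p := (y, v)))
  rw [h2.fderiv]
  simp [add_comm]

/-- The infinitesimal form of the momentum map equation for the tangent lift: if
`s (X, ·) = dh` for the vector field `X = ∂k/∂u (u₀, ·) ξ` generated by `k`, then the
generator `(X, DX v)` of the tangent lift satisfies the same equation for the complete lift of `s`
and the function `(y, v) ↦ dh y v`. -/
theorem formLift_generator {s : E → E [⋀^Fin 2]→L[ℝ] ℝ} {h : E → ℝ} {k : F × E → E}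
    {u ξ : F} {y v : E} (hs : DifferentiableAt ℝ s y) (hh : ContDiffAt ℝ 2 h y)
    (hk : ContDiffAt ℝ 2 k (u, y))
    (hX : ∀ᶠ z in 𝓝 y, ∀ w, s z ![fderiv ℝ k (u, z) (ξ, 0), w] = fderiv ℝ h z w) (b : E × E) :
    formLift s (y, v)
        ![(fderiv ℝ k (u, y) (ξ, 0), fderiv ℝ (fderiv ℝ k) (u, y) (ξ, 0) (0, v)), b] =
      fderiv ℝ (fun q : E × E ↦ fderiv ℝ h q.1 q.2) (y, v) b := by
  have hk' : HasFDerivAt (fderiv ℝ k) (fderiv ℝ (fderiv ℝ k) (u, y)) (u, y) :=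
    ((hk.fderiv_right (m := 1) (by norm_num)).differentiableAt (by simp)).hasFDerivAt
  have hDX : HasFDerivAt (fun z ↦ fderiv ℝ k (u, z) (ξ, 0))
      ((ContinuousLinearMap.apply ℝ E ((ξ, 0) : F × E)) ∘L
        (fderiv ℝ (fderiv ℝ k) (u, y) ∘L ContinuousLinearMap.inr ℝ F E)) y :=
    (ContinuousLinearMap.apply ℝ E ((ξ, 0) : F × E)).hasFDerivAt.comp y
      (HasFDerivAt.comp (g := fderiv ℝ k) y hk' (hasFDerivAt_prodMk_right u y))
  have hl := ((differentiableAt_toBilin hs).hasFDerivAt.clm_apply hDX).clm_apply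
    (hasFDerivAt_const b.1 y)
  have hr := (((hh.fderiv_right (m := 1) (by norm_num)).differentiableAt
    (by simp)).hasFDerivAt.clm_apply (hasFDerivAt_const b.1 y))
  have hlr := (hl.congr_of_eventuallyEq (f₁ := fun z ↦ fderiv ℝ h z b.1) (by
    filter_upwards [hX] with z hz
    rw [toBilin_apply, hz])).unique hr
  have hlr' := DFunLike.congr_fun hlr v
  -- The mixed derivative of `k` is the derivative of `X` in the direction `v`.
  have hsymm : fderiv ℝ (fderiv ℝ k) (u, y) (ξ, 0) (0, v) =
      fderiv ℝ (fderiv ℝ k) (u, y) (0, v) (ξ, 0) :=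
    (hk.isSymmSndFDerivAt (by simp)).eq _ _
  have hsymm' : fderiv ℝ (fderiv ℝ h) y v b.1 = fderiv ℝ (fderiv ℝ h) y b.1 v :=
    (hh.isSymmSndFDerivAt (by simp)).eq _ _
  rw [fderiv_fderiv_apply_prod hh, formLift_apply, hX.self_of_nhds, hsymm, ← hsymm']
  simp [fderiv_toBilin_apply hs] at hlr'
  simp only
  linarith

end Calculus

section Hamiltonian

variable {EG : Type*} [NormedAddCommGroup EG] [NormedSpace ℝ EG]
  {HG : Type*} [TopologicalSpace HG] {IG : ModelWithCorners ℝ EG HG}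
  {G : Type*} [TopologicalSpace G] [ChartedSpace HG G] [Group G]
  {E : Type*} [NormedAddCommGroup E] [NormedSpace ℝ E]
  {H : Type*} [TopologicalSpace H] {I : ModelWithCorners ℝ E H}
  {N : Type*} [TopologicalSpace N] [ChartedSpace H N] {φ : G → N → N}
  {Ω : TwoForm I N} {J : N → GroupLieAlgebra IG G →L[ℝ] ℝ}

/-- Derivatives of a map at equal points agree on the same element of the model space. It moves
vectors between tangent spaces at points that are equal, but not definitionally. -/
theorem mfderiv_apply_congr {E' : Type*} [NormedAddCommGroup E'] [NormedSpace ℝ E']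
    {H' : Type*} [TopologicalSpace H'] {I' : ModelWithCorners ℝ E' H'}
    {N' : Type*} [TopologicalSpace N'] [ChartedSpace H' N'] (F : N → N') {z z' : N} (hz : z = z')
    (a : E) : (mfderiv I I' F z a : E') = mfderiv I I' F z' a := by
  subst hz
  rfl

theorem mfderiv_clm_apply_const {F : Type*} [NormedAddCommGroup F] [NormedSpace ℝ F]
    {J : N → F →L[ℝ] ℝ} {x : N} (hJ : MDifferentiableAt I 𝓘(ℝ, F →L[ℝ] ℝ) J x) (ξ : F)
    (v : TangentSpace I x) :
    mfderiv I 𝓘(ℝ, ℝ) (fun x ↦ J x ξ) x v =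
      DFunLike.coe (F := F →L[ℝ] ℝ) (mfderiv I 𝓘(ℝ, F →L[ℝ] ℝ) J x v) ξ := by
  have hL := (ContinuousLinearMap.apply ℝ ℝ ξ).contMDiff.mdifferentiable (n := 1) (by simp) (J x)
  have h := mfderiv_comp x hL hJ
  rw [mfderiv_eq_fderiv, ContinuousLinearMap.fderiv] at h
  exact DFunLike.congr_fun h v

namespace IsHamiltonianAction

/-- `b_Ω` intertwines the tangent and the cotangent lift of a symplectic action. -/
theorem flat_tangentLift (hφ : IsHamiltonianAction IG I Ω φ J) (g : G) (p : TangentBundle I N) :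
    flat Ω (tangentLift I φ g p) = cotangentLift I φ g (flat Ω p) := by
  obtain ⟨x, v⟩ := p
  refine TotalSpace.ext rfl (heq_of_eq ?_)
  refine ContinuousLinearMap.ext (M₁ := E) fun w ↦ ?_
  -- Invariance is applied to `v` and the preimage `T φ_{g⁻¹} w` of `w`.
  have hx : φ g⁻¹ (φ g x) = x := by
    rw [← hφ.action.mul_act, inv_mul_cancel, hφ.action.one_act]
  have hid : φ g ∘ φ g⁻¹ = id := by
    funext z
    rw [Function.comp_apply, ← hφ.action.mul_act, mul_inv_cancel, hφ.action.one_act, id]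
  have hc := mfderiv_comp (φ g x)
    ((hφ.action.contMDiff_act g).mdifferentiable (by simp) (φ g⁻¹ (φ g x)))
    ((hφ.action.contMDiff_act g⁻¹).mdifferentiable (by simp) (φ g x))
  rw [hid, mfderiv_id] at hc
  have hc' : w = mfderiv I I (φ g) (φ g⁻¹ (φ g x)) (mfderiv I I (φ g⁻¹) (φ g x) w) :=
    DFunLike.congr_fun hc w
  have hc'' := hc'.trans (mfderiv_apply_congr (φ g) hx _)
  have h1 := flat_apply Ω (φ g x) (mfderiv I I (φ g) x v) w
  have h2 := flat_apply Ω x v (mfderiv I I (φ g⁻¹) (φ g x) w)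
  have h3 := hφ.symplectic g x v (mfderiv I I (φ g⁻¹) (φ g x) w)
  refine h1.trans (Eq.trans ?_ (h3.trans h2.symm))
  exact twoForm_congr Ω rfl rfl hc''

/-- The cotangent lift is conjugate to the tangent lift under `b_Ω`, so it is a smooth action. -/
theorem cotangentLift [FiniteDimensional ℝ E] [IsManifold IG ∞ G] [I.Boundaryless]
    [IsManifold I ∞ N] (hΩ : IsSymplecticForm Ω) (hφ : IsHamiltonianAction IG I Ω φ J) :
    IsSmoothAction IG (I.prod 𝓘(ℝ, E →L[ℝ] ℝ)) (cotangentLift I φ) where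
  one_act α := by
    obtain ⟨p, rfl⟩ := hΩ.flat_bijective.2 α
    rw [← hφ.flat_tangentLift, hφ.action.tangentLift.one_act]
  mul_act g h α := by
    obtain ⟨p, rfl⟩ := hΩ.flat_bijective.2 α
    rw [← hφ.flat_tangentLift, ← hφ.flat_tangentLift, ← hφ.flat_tangentLift,
      hφ.action.tangentLift.mul_act]
  smooth := by
    have h1 := hΩ.flatDiffeomorph.contMDiff_toFun.comp (hφ.action.tangentLift.smooth.comp
      (contMDiff_fst.prodMk (hΩ.flatDiffeomorph.contMDiff_invFun.comp contMDiff_snd)))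
    refine h1.congr fun ⟨g, α⟩ ↦ ?_
    obtain ⟨p, rfl⟩ := hΩ.flat_bijective.2 α
    change _ = flat Ω (tangentLift I φ g (hΩ.flatEquiv.symm (hΩ.flatEquiv p)))
    rw [Equiv.symm_apply_apply, hφ.flat_tangentLift]

theorem mdifferentiableAt_momentum (hφ : IsHamiltonianAction IG I Ω φ J) (x : N) :
    MDifferentiableAt (M' := EG →L[ℝ] ℝ) I 𝓘(ℝ, EG →L[ℝ] ℝ) J x :=
  hφ.smooth_momentum.mdifferentiable (by simp) x

theorem contMDiff_momentum_apply (hφ : IsHamiltonianAction IG I Ω φ J) (ξ : GroupLieAlgebra IG G) :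
    ContMDiff I 𝓘(ℝ, ℝ) ∞ (fun x ↦ J x ξ) :=
  ContMDiff.clm_apply (F₁ := EG) (g := J) (f := fun _ ↦ ξ) hφ.smooth_momentum contMDiff_const

/-- The momentum map `-J_{T^*N} ∘ b_Ω` of the tangent lift is the derivative of `J`. -/
theorem neg_cotangentMomentum_flat (hφ : IsHamiltonianAction IG I Ω φ J) (p : TangentBundle I N)
    (ξ : GroupLieAlgebra IG G) :
    (-cotangentMomentum IG I φ (flat Ω p)) ξ =
      mfderiv I 𝓘(ℝ, ℝ) (fun x ↦ J x ξ) p.proj p.snd := by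
  rw [← hφ.momentum]
  have h := flat_apply Ω p.proj p.snd (generator IG I φ p.proj ξ)
  refine (congrArg Neg.neg h).trans ?_
  exact (apply_swap (E := E) (Ω p.proj) _ _).symm

/-- The momentum map of the tangent lift is the fibre component of the tangent map of `J`, hence
smooth. -/
theorem contMDiff_tangentMomentum [IsManifold I ∞ N] (hφ : IsHamiltonianAction IG I Ω φ J) :
    ContMDiff (M' := EG →L[ℝ] ℝ) I.tangent 𝓘(ℝ, EG →L[ℝ] ℝ) ∞
      (fun p : TangentBundle I N ↦ -cotangentMomentum IG I φ (flat Ω p)) := by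
  have h := (contMDiff_snd_tangentBundle_modelSpace (EG →L[ℝ] ℝ) 𝓘(ℝ, EG →L[ℝ] ℝ)).comp
    (hφ.smooth_momentum.contMDiff_tangentMap (m := ∞) (by simp))
  refine h.congr fun p ↦ ?_
  refine ContinuousLinearMap.ext (M₁ := EG) fun ξ ↦ ?_
  exact (hφ.neg_cotangentMomentum_flat p ξ).trans (mfderiv_clm_apply_const (F := EG)
    (hφ.mdifferentiableAt_momentum p.proj) ξ p.snd)

theorem equivariant_tangentMomentum [IsManifold I 1 N] (hφ : IsHamiltonianAction IG I Ω φ J) (g : G)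
    (p : TangentBundle I N) (ξ : GroupLieAlgebra IG G) :
    (-cotangentMomentum IG I φ (flat Ω (tangentLift I φ g p))) ξ =
      (-cotangentMomentum IG I φ (flat Ω p)) (Ad IG g⁻¹ ξ) := by
  rw [hφ.neg_cotangentMomentum_flat, hφ.neg_cotangentMomentum_flat]
  have h := mfderiv_comp p.proj
    ((hφ.contMDiff_momentum_apply ξ).mdifferentiable (by simp) (φ g p.proj))
    ((hφ.action.contMDiff_act g).mdifferentiable (by simp) p.proj)
  have hJ : (fun x ↦ J x ξ) ∘ φ g = fun x ↦ J x (Ad IG g⁻¹ ξ) :=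
    funext fun x ↦ hφ.equivariant g x ξ
  rw [hJ] at h
  exact (DFunLike.congr_fun h p.snd).symm

end IsHamiltonianAction

end Hamiltonian

/-! ### The momentum equation for the tangent lift -/

section Momentum

variable {EG : Type*} [NormedAddCommGroup EG] [NormedSpace ℝ EG]
  {HG : Type*} [TopologicalSpace HG] {IG : ModelWithCorners ℝ EG HG} [IG.Boundaryless]
  {G : Type*} [TopologicalSpace G] [ChartedSpace HG G] [Group G] [IsManifold IG ∞ G]
  {E : Type*} [NormedAddCommGroup E] [NormedSpace ℝ E]
  {H : Type*} [TopologicalSpace H] {I : ModelWithCorners ℝ E H} [I.Boundaryless]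
  {N : Type*} [TopologicalSpace N] [ChartedSpace H N] [IsManifold I ∞ N] {φ : G → N → N}
  {Ω : TwoForm I N} {J : N → GroupLieAlgebra IG G →L[ℝ] ℝ}

variable (IG I) in
/-- The coordinate expression of an action near the identity of the group, in the chart of the
manifold around `x`. -/
def actionRep (φ : G → N → N) (x : N) (z : EG × E) : E :=
  localRep I I (φ ((extChartAt IG (1 : G)).symm z.1)) x x z.2

omit [IG.Boundaryless] [I.Boundaryless] [IsManifold IG ∞ G] [IsManifold I ∞ N] in
theorem actionRep_eq_localRep (φ : G → N → N) (x : N) :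
    actionRep IG I φ x = localRep (IG.prod I) I (fun p : G × N ↦ φ p.1 p.2) ((1 : G), x) x := by
  funext z
  rw [localRep, extChartAt_prod]
  rfl

namespace IsSmoothAction

theorem contDiffAt_actionRep (hφ : IsSmoothAction IG I φ) (x : N) :
    ContDiffAt ℝ ∞ (actionRep IG I φ x) (extChartAt IG (1 : G) 1, extChartAt I x x) := by
  rw [actionRep_eq_localRep]
  refine contDiffAt_localRep ?_ hφ.smooth.contMDiffAt ?_
  · rw [extChartAt_prod]
    exact ⟨mem_extChartAt_target _, mem_extChartAt_target _⟩
  · rw [extChartAt_prod]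
    change φ ((extChartAt IG (1 : G)).symm (extChartAt IG (1 : G) 1))
      ((extChartAt I x).symm (extChartAt I x x)) ∈ _
    rw [extChartAt_to_inv, extChartAt_to_inv, hφ.one_act]
    exact mem_extChartAt_source x

omit [IG.Boundaryless] [I.Boundaryless] [IsManifold IG ∞ G] [IsManifold I ∞ N] in
theorem actionRep_one (hφ : IsSmoothAction IG I φ) {x : N} {y : E}
    (hy : y ∈ (extChartAt I x).target) :
    actionRep IG I φ x (extChartAt IG (1 : G) 1, y) = y := by
  rw [actionRep, localRep, extChartAt_to_inv, hφ.one_act, (extChartAt I x).right_inv hy]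

/-- In coordinates, the generator of the action is the partial derivative of the action in the
direction of the group. -/
theorem chartFrame_fderiv_actionRep (hφ : IsSmoothAction IG I φ) {x : N} {y : E}
    (hy : y ∈ (extChartAt I x).target)
    (hd : DifferentiableAt ℝ (actionRep IG I φ x) (extChartAt IG (1 : G) 1, y)) (ξ : EG) :
    (chartFrame I x y (fderiv ℝ (actionRep IG I φ x) (extChartAt IG (1 : G) 1, y) (ξ, 0)) : E) =
      generator IG I φ ((extChartAt I x).symm y) ξ := by
  set u := extChartAt IG (1 : G) 1 with hu
  have hs : φ ((extChartAt IG (1 : G)).symm u) ((extChartAt I x).symm y) ∈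
      (extChartAt I x).source := by
    rw [hu, extChartAt_to_inv, hφ.one_act]
    exact (extChartAt I x).map_target hy
  have h := chartFrame_fderiv_localRep (F := fun g ↦ φ g ((extChartAt I x).symm y)) (x₁ := x)
    (mem_extChartAt_target (1 : G)) (hφ.contMDiff_orbit (IG := IG) _).contMDiffAt hs ξ
  have h1 : localRep IG I (fun g ↦ φ g ((extChartAt I x).symm y)) (1 : G) x =
      fun a ↦ actionRep IG I φ x (a, y) := rfl
  have h2 : HasFDerivAt (fun a ↦ actionRep IG I φ x (a, y)) _ u :=
    HasFDerivAt.comp (g := actionRep IG I φ x) u hd.hasFDerivAt (hasFDerivAt_prodMk_left u y)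
  rw [← hu, h1, h2.fderiv] at h
  beta_reduce at h
  rw [hu, hφ.actionRep_one hy, ← hu] at h
  rw [ContinuousLinearMap.comp_apply, ContinuousLinearMap.inl_apply] at h
  refine h.trans ?_
  have h3 : (chartFrame IG (1 : G) u ξ : EG) = ξ := chartFrame_self (1 : G) ξ
  refine (congrArg _ h3).trans ?_
  exact mfderiv_apply_congr _ (extChartAt_to_inv (1 : G)) ξ

/-- In coordinates, the generator of the tangent lift is `(X, DX v)`, where `X` is the generator of
the action. -/
theorem generator_tangentLift (hφ : IsSmoothAction IG I φ) (p : TangentBundle I N) (ξ : EG) :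
    (generator IG I.tangent (TangentReduction.tangentLift I φ) p ξ : E × E) =
      (fderiv ℝ (actionRep IG I φ p.proj)
        (extChartAt IG (1 : G) 1, extChartAt I p.proj p.proj) (ξ, 0),
      fderiv ℝ (fderiv ℝ (actionRep IG I φ p.proj))
        (extChartAt IG (1 : G) 1, extChartAt I p.proj p.proj) (ξ, 0) ((0 : EG), p.snd)) := by
  set x := p.proj with hx
  set u := extChartAt IG (1 : G) 1 with hu
  set y := extChartAt I x x with hy
  set k := actionRep IG I φ x with hk
  have hk2 : ContDiffAt ℝ 2 k (u, y) := (hφ.contDiffAt_actionRep x).of_le two_le_infty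
  have hgen := mfderiv_apply_eq_fderiv_localRep
    ((hφ.tangentLift.contMDiff_orbit p).mdifferentiable (by simp) (1 : G)) ξ
  rw [hφ.tangentLift.one_act] at hgen
  refine hgen.trans ?_
  have hcont : ContinuousAt (fun a ↦ φ ((extChartAt IG (1 : G)).symm a) x) u :=
    (hφ.contMDiff_orbit (IG := IG) x).continuous.continuousAt.comp
      (f := (extChartAt IG (1 : G)).symm) (continuousAt_extChartAt_symm (1 : G))
  have hsrc : ∀ᶠ a in 𝓝 u, φ ((extChartAt IG (1 : G)).symm a) x ∈ (extChartAt I x).source := by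
    refine hcont.eventually ((isOpen_extChartAt_source x).mem_nhds ?_)
    beta_reduce
    rw [hu, extChartAt_to_inv, hφ.one_act]
    exact mem_extChartAt_source x
  -- Order two, because being `C^∞` at a point is not an open condition, unlike finite order.
  have hdiff : ∀ᶠ a in 𝓝 u, ContDiffAt ℝ 2 k (a, y) :=
    (Continuous.prodMk_left y).continuousAt.eventually (hk2.eventually (by decide))
  -- Along the group, the tangent lift of the single vector `v` is the partial derivative of the
  -- action in the direction `v`; its derivative at the identity is a mixed second derivative.
  have hev : localRep IG I.tangent (fun g ↦ TangentReduction.tangentLift I φ g p) (1 : G) p =ᶠ[𝓝 u]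
      fun a ↦ (k (a, y), fderiv ℝ k (a, y) ((0 : EG), p.snd)) := by
    filter_upwards [hsrc, hdiff] with a ha hda
    have hy' : (extChartAt I.tangent p p).1 ∈ (extChartAt I p.proj).target := by
      rw [tangent_extChartAt_self]
      exact mem_extChartAt_target x
    have h := localRep_tangentMap (p' := p) hy'
      (hφ.contMDiff_act ((extChartAt IG (1 : G)).symm a)).contMDiffAt (by
        rw [tangent_extChartAt_self, extChartAt_to_inv]
        exact ha)
    rw [localRep, extChartAt_to_inv, tangent_extChartAt_self] at h
    refine h.trans (Prod.ext rfl ?_)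
    have h2 : HasFDerivAt (fun z ↦ k (a, z)) _ y :=
      HasFDerivAt.comp (g := k) y (hda.differentiableAt (by simp)).hasFDerivAt
        (hasFDerivAt_prodMk_right a y)
    exact DFunLike.congr_fun h2.fderiv p.snd
  rw [hev.fderiv_eq]
  have h1 : HasFDerivAt (fun a ↦ k (a, y)) _ u :=
    HasFDerivAt.comp (g := k) u (hk2.differentiableAt (by simp)).hasFDerivAt
      (hasFDerivAt_prodMk_left u y)
  have h2 : HasFDerivAt (fun a ↦ fderiv ℝ k (a, y)) _ u :=
    HasFDerivAt.comp (g := fderiv ℝ k) u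
      ((hk2.fderiv_right (m := 1) (by norm_num)).differentiableAt (by simp)).hasFDerivAt
      (hasFDerivAt_prodMk_left u y)
  have h3 := h1.prodMk (h2.clm_apply (hasFDerivAt_const ((0 : EG), (p.snd : E)) u))
  refine (DFunLike.congr_fun h3.fderiv ξ).trans (Prod.ext rfl ?_)
  exact (congrArg₂ (· + ·) (map_zero (fderiv ℝ k (u, y))) rfl).trans (zero_add _)

end IsSmoothAction

namespace IsHamiltonianAction

omit [IG.Boundaryless] [IsManifold IG ∞ G] in
/-- The derivative of the coordinate expression of `J_ξ`. -/
theorem fderiv_momentum_chart (hφ : IsHamiltonianAction IG I Ω φ J) (ξ : GroupLieAlgebra IG G)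
    {x : N} {y : E} (hy : y ∈ (extChartAt I x).target) (w : E) :
    fderiv ℝ (fun z ↦ J ((extChartAt I x).symm z) ξ) y w =
      mfderiv I 𝓘(ℝ, ℝ) (fun z ↦ J z ξ) ((extChartAt I x).symm y) (chartFrame I x y w) := by
  have h := mfderiv_comp y
    ((hφ.contMDiff_momentum_apply ξ).mdifferentiable (by simp) ((extChartAt I x).symm y))
    (mdifferentiableAt_extChartAt_symm hy)
  rw [mfderiv_eq_fderiv, ← chartFrame_eq_mfderiv] at h
  exact DFunLike.congr_fun h w

/-- The momentum equation for the tangent lift; it is `formLift_generator` in the chart centred at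
`p`. -/
theorem momentum_tangentLift (hΩ : IsSymplecticForm Ω) (hφ : IsHamiltonianAction IG I Ω φ J)
    (ξ : GroupLieAlgebra IG G) (p : TangentBundle I N) (b : TangentSpace I.tangent p) :
    completeLift Ω p ![generator IG I.tangent (tangentLift I φ) p ξ, b] =
      mfderiv I.tangent 𝓘(ℝ, ℝ)
        (fun q : TangentBundle I N ↦ (-cotangentMomentum IG I φ (flat Ω q)) ξ) p b := by
  set x := p.proj with hx
  set y := extChartAt I x x with hy
  let v : E := p.snd
  have hself : extChartAt I.tangent p p = (y, v) := tangent_extChartAt_self p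
  set h : E → ℝ := fun z ↦ J ((extChartAt I x).symm z) ξ with hh
  have hyt : y ∈ (extChartAt I x).target := mem_extChartAt_target x
  have htarget : ∀ᶠ z in 𝓝 y, z ∈ (extChartAt I x).target :=
    (isOpen_extChartAt_target x).mem_nhds hyt
  have hh2 : ContDiffAt ℝ 2 h y := by
    refine ContDiffAt.of_le ?_ two_le_infty
    have h1 := contDiffAt_localRep (x₁ := J x ξ) hyt
      (hφ.contMDiff_momentum_apply ξ).contMDiffAt (by rw [extChartAt_source]; trivial)
    exact h1
  have hk := hφ.action.contDiffAt_actionRep x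
  have hX : ∀ᶠ z in 𝓝 y, ∀ w, chartForm Ω x z
      ![fderiv ℝ (actionRep IG I φ x) (extChartAt IG (1 : G) 1, z) (ξ, 0), w] =
        fderiv ℝ h z w := by
    have hd : ∀ᶠ z in 𝓝 y, ContDiffAt ℝ 2 (actionRep IG I φ x) (extChartAt IG (1 : G) 1, z) :=
      (Continuous.prodMk_right _).continuousAt.eventually
        ((hk.of_le two_le_infty).eventually (by decide))
    filter_upwards [htarget, hd] with z hz hdz w
    rw [hφ.fderiv_momentum_chart ξ hz, ← hφ.momentum, chartForm_apply]
    exact twoForm_congr Ω rfl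
      (hφ.action.chartFrame_fderiv_actionRep hz (hdz.differentiableAt (by simp)) ξ) rfl
  have hL := formLift_generator (v := v)
    ((hΩ.contDiffAt_chartForm hyt).differentiableAt (by simp)) hh2 (hk.of_le two_le_infty) hX b
  have hT : MDifferentiableAt I.tangent 𝓘(ℝ, ℝ)
      (fun q : TangentBundle I N ↦ (-cotangentMomentum IG I φ (flat Ω q)) ξ) p :=
    (ContMDiff.clm_apply (F₁ := EG)
      (g := fun q : TangentBundle I N ↦ -cotangentMomentum IG I φ (flat Ω q)) (f := fun _ ↦ ξ)
      hφ.contMDiff_tangentMomentum contMDiff_const).mdifferentiable (by simp) p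
  have hR := mfderiv_apply_eq_fderiv_localRep hT b
  have hev : localRep I.tangent 𝓘(ℝ, ℝ)
      (fun q : TangentBundle I N ↦ (-cotangentMomentum IG I φ (flat Ω q)) ξ) p
      ((-cotangentMomentum IG I φ (flat Ω p)) ξ) =ᶠ[𝓝 (y, v)]
        fun q : E × E ↦ fderiv ℝ h q.1 q.2 := by
    filter_upwards [continuousAt_fst.eventually htarget] with q hq
    change (-cotangentMomentum IG I φ (flat Ω ((extChartAt I.tangent p).symm (q.1, q.2)))) ξ = _
    rw [tangent_extChartAt_symm hq, hφ.neg_cotangentMomentum_flat, hφ.fderiv_momentum_chart ξ hq]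
  rw [hself, hev.fderiv_eq] at hR
  refine Eq.trans ?_ (hL.trans hR.symm)
  rw [completeLift_eq_formLift, hself]
  exact congrArg (fun a : E × E ↦ formLift (chartForm Ω x) (y, v) ![a, b])
    (hφ.action.generator_tangentLift p ξ)

/-- The tangent lift of a Hamiltonian action is Hamiltonian for the complete lift. -/
theorem tangentLift (hΩ : IsSymplecticForm Ω) (hφ : IsHamiltonianAction IG I Ω φ J) :
    IsHamiltonianAction IG I.tangent (completeLift Ω) (tangentLift I φ)
      (fun p ↦ -cotangentMomentum IG I φ (flat Ω p)) where
  action := hφ.action.tangentLift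
  symplectic g p a b := completeLift_tangentMap hΩ hΩ (hφ.action.contMDiff_act g)
    (hφ.symplectic g) p a b
  smooth_momentum := hφ.contMDiff_tangentMomentum
  momentum ξ p b := hφ.momentum_tangentLift hΩ ξ p b
  equivariant := hφ.equivariant_tangentMomentum

end IsHamiltonianAction

end Momentum

end TangentReduction

end

theorem theorem4p1
    {EG : Type*} [NormedAddCommGroup EG] [NormedSpace ℝ EG] [FiniteDimensional ℝ EG]
    {HG : Type*} [TopologicalSpace HG] (IG : ModelWithCorners ℝ EG HG) [IG.Boundaryless]
    {G : Type*} [TopologicalSpace G] [ChartedSpace HG G] [Group G] [LieGroup IG ∞ G]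
    {E : Type*} [NormedAddCommGroup E] [NormedSpace ℝ E] [FiniteDimensional ℝ E]
    {H : Type*} [TopologicalSpace H] (I : ModelWithCorners ℝ E H) [I.Boundaryless]
    {M : Type*} [TopologicalSpace M] [ChartedSpace H M] [IsManifold I ∞ M]
    (Ω : TangentReduction.TwoForm I M) (hΩ : TangentReduction.IsSymplecticForm Ω)
    (φ : G → M → M) (J : M → GroupLieAlgebra IG G →L[ℝ] ℝ)
    (hφ : TangentReduction.IsHamiltonianAction IG I Ω φ J) :
    -- `b_Ω` is a vector bundle isomorphism
    ((∀ x : M, ∃ L : TangentSpace I x ≃L[ℝ] (TangentSpace I x →L[ℝ] ℝ),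
        ∀ v : TangentSpace I x, TangentReduction.flat Ω ⟨x, v⟩ = ⟨x, L v⟩) ∧
      ∃ Φ : Diffeomorph I.tangent (I.prod 𝓘(ℝ, E →L[ℝ] ℝ))
          (TangentBundle I M) (TangentReduction.CotangentBundle I M) ∞,
        ∀ v : TangentBundle I M, Φ v = TangentReduction.flat Ω v) ∧
    -- the cotangent lift is an action, and `b_Ω` is equivariant
    TangentReduction.IsSmoothAction IG (I.prod 𝓘(ℝ, E →L[ℝ] ℝ))
      (TangentReduction.cotangentLift I φ) ∧
    (∀ (g : G) (v : TangentBundle I M),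
      TangentReduction.flat Ω (TangentReduction.tangentLift I φ g v) =
        TangentReduction.cotangentLift I φ g (TangentReduction.flat Ω v)) ∧
    -- the tangent lift is Hamiltonian on the symplectic manifold `(TM, Ω^c)`
    TangentReduction.IsSymplecticForm (TangentReduction.completeLift Ω) ∧
    ∃ JTM : TangentBundle I M → GroupLieAlgebra IG G →L[ℝ] ℝ,
      TangentReduction.IsHamiltonianAction IG I.tangent (TangentReduction.completeLift Ω)
        (TangentReduction.tangentLift I φ) JTM ∧
      (∀ F : TangentBundle I M → GroupLieAlgebra IG G →L[ℝ] ℝ,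
        F = JTM ↔ ∀ (v : TangentBundle I M) (ξ : GroupLieAlgebra IG G),
          F v ξ = mfderiv I 𝓘(ℝ, ℝ) (fun x ↦ J x ξ) v.proj v.snd) ∧
      JTM = fun v ↦ -TangentReduction.cotangentMomentum IG I φ (TangentReduction.flat Ω v) := by
  refine ⟨⟨hΩ.exists_flat_equiv, hΩ.flatDiffeomorph, fun v ↦ rfl⟩, hφ.cotangentLift hΩ,
    hφ.flat_tangentLift, hΩ.completeLift,
    fun v ↦ -TangentReduction.cotangentMomentum IG I φ (TangentReduction.flat Ω v),
    hφ.tangentLift hΩ, fun F ↦ ⟨?_, fun hF ↦ ?_⟩, rfl⟩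
  · rintro rfl v ξ
    exact hφ.neg_cotangentMomentum_flat v ξ
  · funext v
    ext ξ
    exact (hF v ξ).trans (hφ.neg_cotangentMomentum_flat v ξ).symm
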